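/- Let $\mu$ be Lebesgue measure on $\mathbb R$, and let $\mathcal M(\mu)$ be the set of all invertible bimeasurable $\mu$-preserving transformations $T:\mathbb R\to\mathbb R$, where transformations that agree $\mu$-almost everywhere are identified. Let $(D_i)_{i\ge 1}$ enumerate the nonempty finite unions of dyadic intervals $[k/2^j,(k+1)/2^j)$ ($k\in\mathbb Z$, $j\in\mathbb N$), and give $\mathcal M(\mu)$ the weak topology, i.e. the topology of the metric $$d(T,S)=\sum_{i=1}^\infty \frac{\mu\bigl(T^{-1}(D_i)\,\triangle\, S^{-1}(D_i)\bigr)}{2^i\mu(D_i)}.$$ A measure-preserving transformation is *ergodic* if every measurable invariant set is null or conull, and *conservative* if for every measurable $A$ of positive measure there is $n\neq 0$ such that the $n$-th image of $A$ meets $A$ in positive measure. Let $(T\times S)(x,y)=(Tx,Sy)$ on $(\mathbb R^2,\mu\times\mu)$. For $T\in\mathcal M(\mu)$ let - $E(T)$ be the set of ergodic $S\in\mathcal M(\mu)$ such that $T\times S$ is ergodic; - $\bar EC(T)$ be the set of ergodic $S\in\mathcal M(\mu)$ such that $T\times S$ is conservative but not ergodic; - $\bar C(T)$ be the set of ergodic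 $S\in\mathcal M(\mu)$ such that $T\times S$ is not conservative. Call $S\in\mathcal M(\mu)$ *anti-periodic* if for every $n\ge 1$ and every measurable $A$ with $\mu(A)>0$ there is a measurable $B\subset A$ with $\mu(S^{-n}(B)\setminus B)>0$ and $\mu(B\setminus S^{-n}(B))>0$. **Theorem.** Let $T\in\mathcal M(\mu)$, and let $S\in\mathcal M(\mu)$ be anti-periodic. 1. If $S\in E(T)$, then $E(T)$ is a dense $G_\delta$ set in $\mathcal M(\mu)$. 2. If $S\in\bar EC(T)$, then $\bar EC(T)$ is dense in $\mathcal M(\mu)$. 3. If $S\in\bar C(T)$, then $\bar C(T)$ is dense in $\mathcal M(\mu)$. -/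

import Mathlib

open MeasureTheory Set
open scoped symmDiff

noncomputable section

namespace ErgodicCategory

/-- The dyadic interval `[k / 2 ^ j, (k + 1) / 2 ^ j)`. -/
def dyadicInterval (k : ℤ) (j : ℕ) : Set ℝ :=
  Set.Ico ((k : ℝ) / 2 ^ j) (((k : ℝ) + 1) / 2 ^ j)

/-- A dyadic set is a finite union of dyadic intervals. -/
def IsDyadicSet (D : Set ℝ) : Prop :=
  ∃ F : Finset (ℤ × ℕ), D = ⋃ p ∈ F, dyadicInterval p.1 p.2

theorem dyadicInterval_nonempty (k : ℤ) (j : ℕ) : (dyadicInterval k j).Nonempty := by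
  refine Set.nonempty_Ico.2 ?_
  gcongr
  linarith

theorem isDyadicSet_dyadicInterval (k : ℤ) (j : ℕ) : IsDyadicSet (dyadicInterval k j) :=
  ⟨{(k, j)}, by simp⟩

theorem IsDyadicSet.measurableSet {D : Set ℝ} (h : IsDyadicSet D) : MeasurableSet D := by
  obtain ⟨F, rfl⟩ := h
  exact Finset.measurableSet_biUnion _ fun p _ => measurableSet_Ico

theorem IsDyadicSet.volume_ne_top {D : Set ℝ} (h : IsDyadicSet D) : volume D ≠ ⊤ := by
  obtain ⟨F, rfl⟩ := h
  refine ((measure_biUnion_finset_le F _).trans_lt ?_).ne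
  refine ENNReal.sum_lt_top.2 fun p _ => ?_
  simp [dyadicInterval]

/-- The family of nonempty dyadic sets. -/
def dyadicSets : Set (Set ℝ) := {D | IsDyadicSet D ∧ D.Nonempty}

theorem exists_enumeration :
    ∃ D : ℕ → Set ℝ, Function.Injective D ∧ Set.range D = dyadicSets := by
  have hc : dyadicSets.Countable := by
    refine (Set.countable_range
      (fun F : Finset (ℤ × ℕ) => ⋃ p ∈ F, dyadicInterval p.1 p.2)).mono ?_
    rintro D ⟨⟨F, rfl⟩, -⟩
    exact ⟨F, rfl⟩
  have hi : dyadicSets.Infinite := by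
    refine Set.infinite_of_injective_forall_mem (f := fun k : ℤ => dyadicInterval k 0) ?_
      fun k => ⟨isDyadicSet_dyadicInterval k 0, dyadicInterval_nonempty k 0⟩
    intro k l h
    replace h : dyadicInterval k 0 = dyadicInterval l 0 := h
    have h1 : (k : ℝ) ∈ dyadicInterval l 0 := by
      have : (k : ℝ) ∈ dyadicInterval k 0 := by simp [dyadicInterval]
      exact h ▸ this
    have h2 : (l : ℝ) ∈ dyadicInterval k 0 := by
      have : (l : ℝ) ∈ dyadicInterval l 0 := by simp [dyadicInterval]
      exact h.symm ▸ this
    simp only [dyadicInterval, pow_zero, div_one, Set.mem_Ico] at h1 h2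
    exact_mod_cast le_antisymm h2.1 h1.1
  have := hc.to_subtype
  have := hi.to_subtype
  obtain ⟨e⟩ := nonempty_equiv_of_countable (α := ℕ) (β := dyadicSets)
  refine ⟨fun n => (e n : Set ℝ), Subtype.val_injective.comp e.injective, ?_⟩
  ext D
  constructor
  · rintro ⟨n, rfl⟩
    exact (e n).2
  · intro h
    exact ⟨e.symm ⟨D, h⟩, by simp⟩

/-- An enumeration without repetitions of all nonempty dyadic sets. -/
def dyadicEnum : ℕ → Set ℝ := Classical.choose exists_enumeration

theorem dyadicEnum_injective : Function.Injective dyadicEnum :=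
  (Classical.choose_spec exists_enumeration).1

theorem range_dyadicEnum : Set.range dyadicEnum = dyadicSets :=
  (Classical.choose_spec exists_enumeration).2

theorem isDyadicSet_dyadicEnum (i : ℕ) : IsDyadicSet (dyadicEnum i) := by
  have : dyadicEnum i ∈ dyadicSets := range_dyadicEnum ▸ Set.mem_range_self i
  exact this.1

/-- Invertible, bi-measurable transformations of the real line that preserve Lebesgue measure,
before identifying transformations that agree almost everywhere. -/
abbrev Transformation : Type := {T : ℝ ≃ᵐ ℝ // MeasurePreserving T volume volume}

/-- Equality almost everywhere. -/
instance transformationSetoid : Setoid Transformation where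
  r T S := (T.1 : ℝ → ℝ) =ᵐ[volume] (S.1 : ℝ → ℝ)
  iseqv := ⟨fun _ => Filter.EventuallyEq.rfl, fun h => h.symm, fun h h' => h.trans h'⟩

/-- The space `M(μ)` of invertible transformations of the real line that preserve Lebesgue
measure `μ`, where transformations that agree almost everywhere are identified. -/
def M : Type := Quotient transformationSetoid

/-- The `i`-th term of the series that defines the weak distance. -/
def weakTerm (T S : Transformation) (i : ℕ) : ℝ :=
  volume.real ((T.1 ⁻¹' dyadicEnum i) ∆ (S.1 ⁻¹' dyadicEnum i)) /
    (2 ^ (i + 1) * volume.real (dyadicEnum i))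

/-- `d(T, S) = ∑ i, μ (T⁻¹ Dᵢ ∆ S⁻¹ Dᵢ) / (2 ^ i * μ Dᵢ)`, the sum starting with weight `1 / 2`. -/
def weakDist (T S : Transformation) : ℝ := ∑' i, weakTerm T S i

theorem volume_preimage (T : Transformation) (i : ℕ) :
    volume (T.1 ⁻¹' dyadicEnum i) = volume (dyadicEnum i) :=
  T.2.measure_preimage (isDyadicSet_dyadicEnum i).measurableSet.nullMeasurableSet

theorem volume_preimage_ne_top (T : Transformation) (i : ℕ) :
    volume (T.1 ⁻¹' dyadicEnum i) ≠ ⊤ := by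
  rw [volume_preimage]
  exact (isDyadicSet_dyadicEnum i).volume_ne_top

theorem volume_symmDiff_ne_top (T S : Transformation) (i : ℕ) :
    volume ((T.1 ⁻¹' dyadicEnum i) ∆ (S.1 ⁻¹' dyadicEnum i)) ≠ ⊤ :=
  ((measure_mono Set.symmDiff_subset_union).trans_lt
    (measure_union_lt_top (volume_preimage_ne_top T i).lt_top
      (volume_preimage_ne_top S i).lt_top)).ne

theorem weakTerm_nonneg (T S : Transformation) (i : ℕ) : 0 ≤ weakTerm T S i := by
  unfold weakTerm
  positivity

theorem weakTerm_le (T S : Transformation) (i : ℕ) : weakTerm T S i ≤ (1 / 2) ^ i := by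
  have h1 : volume.real ((T.1 ⁻¹' dyadicEnum i) ∆ (S.1 ⁻¹' dyadicEnum i)) ≤
      2 * volume.real (dyadicEnum i) := by
    calc _ ≤ volume.real ((T.1 ⁻¹' dyadicEnum i) ∪ (S.1 ⁻¹' dyadicEnum i)) :=
          measureReal_mono Set.symmDiff_subset_union
            (measure_union_ne_top (volume_preimage_ne_top T i) (volume_preimage_ne_top S i))
      _ ≤ volume.real (T.1 ⁻¹' dyadicEnum i) + volume.real (S.1 ⁻¹' dyadicEnum i) :=
          measureReal_union_le _ _
      _ = 2 * volume.real (dyadicEnum i) := by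
          simp only [measureReal_def, volume_preimage]
          ring
  unfold weakTerm
  refine div_le_of_le_mul₀ (by positivity) (by positivity) (h1.trans (le_of_eq ?_))
  rw [pow_succ, one_div, inv_pow]
  field_simp

theorem summable_weakTerm (T S : Transformation) : Summable (weakTerm T S) :=
  Summable.of_nonneg_of_le (weakTerm_nonneg T S) (weakTerm_le T S)
    (summable_geometric_of_lt_one (by norm_num) (by norm_num))

theorem weakDist_self (T : Transformation) : weakDist T T = 0 := by
  simp [weakDist, weakTerm]

theorem weakDist_comm (T S : Transformation) : weakDist T S = weakDist S T := by
  simp only [weakDist, weakTerm, symmDiff_comm]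

theorem weakDist_triangle (T S R : Transformation) :
    weakDist T R ≤ weakDist T S + weakDist S R := by
  unfold weakDist
  rw [← (summable_weakTerm T S).tsum_add (summable_weakTerm S R)]
  refine (summable_weakTerm T R).tsum_le_tsum (fun i => ?_)
    ((summable_weakTerm T S).add (summable_weakTerm S R))
  unfold weakTerm
  rw [← add_div]
  gcongr
  refine (measureReal_mono (symmDiff_triangle _ (S.1 ⁻¹' dyadicEnum i) _) ?_).trans
    (measureReal_union_le _ _)
  exact measure_union_ne_top (volume_symmDiff_ne_top T S i) (volume_symmDiff_ne_top S R i)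

theorem weakDist_congr {T T' S S' : Transformation} (hT : T ≈ T') (hS : S ≈ S') :
    weakDist T S = weakDist T' S' := by
  have h0 : ∀ {A B : Transformation}, A ≈ B → weakDist A B = 0 := by
    intro A B h
    have : ∀ i, weakTerm A B i = 0 := by
      intro i
      have h' : (A.1 ⁻¹' dyadicEnum i : Set ℝ) =ᵐ[volume] (B.1 ⁻¹' dyadicEnum i : Set ℝ) :=
        Filter.EventuallyEq.preimage h _
      simp [weakTerm, measureReal_def, measure_symmDiff_eq_zero_iff.2 h']
    simp [weakDist, this]
  have := weakDist_triangle T T' S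
  have := weakDist_triangle T' S' S
  have := weakDist_triangle T' T S'
  have := weakDist_triangle T S S'
  have := h0 hT
  have := h0 hS
  have := weakDist_comm T T'
  have := weakDist_comm S S'
  linarith

/-- Dyadic intervals separate points. -/
theorem exists_dyadic_separating {x y : ℝ} (h : x < y) :
    ∃ i, x ∈ dyadicEnum i ∧ y ∉ dyadicEnum i := by
  obtain ⟨j, hj⟩ := exists_pow_lt_of_lt_one (sub_pos.2 h) (show (1 / 2 : ℝ) < 1 by norm_num)
  have h2 : (0 : ℝ) < 2 ^ j := by positivity
  have hmem : dyadicInterval ⌊x * 2 ^ j⌋ j ∈ Set.range dyadicEnum := by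
    rw [range_dyadicEnum]
    exact ⟨isDyadicSet_dyadicInterval _ _, dyadicInterval_nonempty _ _⟩
  obtain ⟨i, hi⟩ := hmem
  refine ⟨i, ?_, ?_⟩ <;> rw [hi] <;> simp only [dyadicInterval, Set.mem_Ico]
  · exact ⟨(div_le_iff₀ h2).2 (Int.floor_le _), (lt_div_iff₀ h2).2 (Int.lt_floor_add_one _)⟩
  · rintro ⟨-, hy⟩
    rw [lt_div_iff₀ h2] at hy
    have hx := Int.floor_le (x * 2 ^ j)
    have : (1 / 2 : ℝ) ^ j * 2 ^ j = 1 := by rw [← mul_pow]; norm_num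
    nlinarith

theorem equiv_of_weakDist_eq_zero {T S : Transformation} (h : weakDist T S = 0) : T ≈ S := by
  have h1 : ∀ i, weakTerm T S i = 0 := fun i => by
    have := (hasSum_zero_iff_of_nonneg (weakTerm_nonneg T S)).1
      (by
        have hs := (summable_weakTerm T S).hasSum
        rwa [show ∑' i, weakTerm T S i = 0 from h] at hs)
    exact congrFun this i
  have hpos : ∀ i, volume (dyadicEnum i) ≠ 0 := by
    intro i
    have hi : dyadicEnum i ∈ dyadicSets := range_dyadicEnum ▸ Set.mem_range_self i
    obtain ⟨⟨F, hF⟩, x, hx⟩ := hi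
    rw [hF] at hx
    simp only [Set.mem_iUnion] at hx
    obtain ⟨p, hp, -⟩ := hx
    have hsub : dyadicInterval p.1 p.2 ⊆ dyadicEnum i := by
      rw [hF]
      exact Set.subset_biUnion_of_mem (u := fun p : ℤ × ℕ => dyadicInterval p.1 p.2) hp
    intro h0
    have h3 := measure_mono_null hsub h0
    have h4 := Set.nonempty_Ico.1 (dyadicInterval_nonempty p.1 p.2)
    simp only [dyadicInterval, Real.volume_Ico, ENNReal.ofReal_eq_zero] at h3
    linarith
  have h2 : ∀ i, volume ((T.1 ⁻¹' dyadicEnum i) ∆ (S.1 ⁻¹' dyadicEnum i)) = 0 := by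
    intro i
    have hd : volume.real (dyadicEnum i) ≠ 0 :=
      ENNReal.toReal_ne_zero.2 ⟨hpos i, (isDyadicSet_dyadicEnum i).volume_ne_top⟩
    have hw := h1 i
    unfold weakTerm at hw
    rw [div_eq_zero_iff] at hw
    rcases hw with hw | hw
    · exact (measureReal_eq_zero_iff (volume_symmDiff_ne_top T S i)).1 hw
    · exact absurd hw (mul_ne_zero (by positivity) hd)
  refine measure_mono_null ?_ (measure_iUnion_null h2)
  intro x hx
  rw [Set.mem_iUnion]
  rcases lt_or_gt_of_ne (show T.1 x ≠ S.1 x from hx) with hlt | hlt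
  · obtain ⟨i, hi, hi'⟩ := exists_dyadic_separating hlt
    exact ⟨i, Or.inl ⟨hi, hi'⟩⟩
  · obtain ⟨i, hi, hi'⟩ := exists_dyadic_separating hlt
    exact ⟨i, Or.inr ⟨hi, hi'⟩⟩

/-- The metric `d` on `M(μ)`; its topology is the weak topology. -/
instance : MetricSpace M where
  dist := Quotient.lift₂ weakDist fun _ _ _ _ hT hS => weakDist_congr hT hS
  dist_self := by
    rintro ⟨T⟩
    exact weakDist_self T
  dist_comm := by
    rintro ⟨T⟩ ⟨S⟩
    exact weakDist_comm T S
  dist_triangle := by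
    rintro ⟨T⟩ ⟨S⟩ ⟨R⟩
    exact weakDist_triangle T S R
  eq_of_dist_eq_zero := by
    rintro ⟨T⟩ ⟨S⟩ h
    exact Quotient.sound (equiv_of_weakDist_eq_zero h)

/-! ### Ergodicity, conservativity and anti-periodicity do not see null sets -/

theorem ergodic_congr {X : Type*} [MeasurableSpace X] {μ : Measure X} {f g : X → X}
    (hf : Ergodic f μ) (hg : MeasurePreserving g μ μ) (h : f =ᵐ[μ] g) : Ergodic g μ := by
  refine ⟨hg, ⟨fun s hs hgs => ?_⟩⟩
  have h1 : f ⁻¹' s =ᵐ[μ] s := by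
    have := h.preimage s
    rwa [hgs] at this
  exact Filter.eventuallyConst_set'.2
    (hf.quasiErgodic.ae_empty_or_univ₀ hs.nullMeasurableSet h1)

theorem iterate_congr {X : Type*} [MeasurableSpace X] {μ : Measure X} {f g : X → X}
    (hf : Measure.QuasiMeasurePreserving f μ μ) (h : f =ᵐ[μ] g) (n : ℕ) : f^[n] =ᵐ[μ] g^[n] := by
  induction n with
  | zero => exact Filter.EventuallyEq.rfl
  | succ n ih =>
    have h1 : f^[n] ∘ f =ᵐ[μ] g^[n] ∘ f := hf.ae_eq_comp ih
    have h2 : g^[n] ∘ f =ᵐ[μ] g^[n] ∘ g := h.fun_comp g^[n]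
    simpa only [Function.iterate_succ] using h1.trans h2

theorem conservative_congr {X : Type*} [MeasurableSpace X] {μ : Measure X} {f g : X → X}
    (hf : Conservative f μ) (hg : MeasurePreserving g μ μ) (h : f =ᵐ[μ] g) :
    Conservative g μ := by
  refine ⟨hg.quasiMeasurePreserving, fun s hs h0 => ?_⟩
  obtain ⟨m, hm, hm0⟩ := ((hf.frequently_measure_inter_ne_zero hs.nullMeasurableSet h0).and_eventually
    (Filter.eventually_ne_atTop 0)).exists
  have h1 : (s ∩ f^[m] ⁻¹' s : Set X) =ᵐ[μ] (s ∩ g^[m] ⁻¹' s : Set X) :=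
    Filter.EventuallyEq.rfl.inter ((iterate_congr hf.toQuasiMeasurePreserving h m).preimage s)
  rw [measure_congr h1] at hm
  obtain ⟨x, hx, hx'⟩ := nonempty_of_measure_ne_zero hm
  exact ⟨x, hx, m, hm0, hx'⟩

/-- The product transformation `(x, y) ↦ (T x, S y)`. -/
def prodMap (T S : Transformation) : ℝ × ℝ → ℝ × ℝ := Prod.map T.1 S.1

theorem measurePreserving_prodMap (T S : Transformation) :
    MeasurePreserving (prodMap T S) (volume.prod volume) (volume.prod volume) :=
  T.2.prod S.2

theorem prodMap_congr {T T' S S' : Transformation} (hT : T ≈ T') (hS : S ≈ S') :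
    prodMap T S =ᵐ[volume.prod volume] prodMap T' S' := by
  have h1 := (Measure.quasiMeasurePreserving_fst (μ := (volume : Measure ℝ))
    (ν := (volume : Measure ℝ))).ae_eq_comp hT
  have h2 := (Measure.quasiMeasurePreserving_snd (μ := (volume : Measure ℝ))
    (ν := (volume : Measure ℝ))).ae_eq_comp hS
  filter_upwards [h1, h2] with z hz1 hz2
  exact Prod.ext hz1 hz2

/-- `T` is ergodic. -/
def IsErgodic : M → Prop :=
  Quotient.lift (fun T : Transformation => Ergodic T.1 volume) fun T S h =>
    propext ⟨fun hT => ergodic_congr hT S.2 h, fun hS => ergodic_congr hS T.2 h.symm⟩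

/-- The product `T × S` is ergodic. -/
def ProdErgodic : M → M → Prop :=
  Quotient.lift₂ (fun T S : Transformation => Ergodic (prodMap T S) (volume.prod volume))
    fun T S T' S' hT hS => propext
      ⟨fun h => ergodic_congr h (measurePreserving_prodMap T' S') (prodMap_congr hT hS),
        fun h => ergodic_congr h (measurePreserving_prodMap T S) (prodMap_congr hT hS).symm⟩

/-- The product `T × S` is conservative. -/
def ProdConservative : M → M → Prop :=
  Quotient.lift₂ (fun T S : Transformation => Conservative (prodMap T S) (volume.prod volume))
    fun T S T' S' hT hS => propext
      ⟨fun h => conservative_congr h (measurePreserving_prodMap T' S') (prodMap_congr hT hS),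
        fun h => conservative_congr h (measurePreserving_prodMap T S) (prodMap_congr hT hS).symm⟩

/-- Anti-periodicity of a transformation. Sets are measurable and are compared up
to null sets: `A` ranges over the sets of positive measure, and `≠ ∅` means positive measure. -/
def AntiPeriodic (T : Transformation) : Prop :=
  ∀ n : ℕ, 1 ≤ n → ∀ A : Set ℝ, MeasurableSet A → 0 < volume A →
    ∃ B ⊆ A, MeasurableSet B ∧
      0 < volume (((T.1 : ℝ → ℝ)^[n] ⁻¹' B) \ B) ∧ 0 < volume (B \ ((T.1 : ℝ → ℝ)^[n] ⁻¹' B))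

theorem AntiPeriodic.congr {T S : Transformation} (hT : AntiPeriodic T) (h : T ≈ S) :
    AntiPeriodic S := by
  intro n hn A hA hA0
  obtain ⟨B, hBA, hB, h1, h2⟩ := hT n hn A hA hA0
  have h3 : ((T.1 : ℝ → ℝ)^[n] ⁻¹' B : Set ℝ) =ᵐ[volume] ((S.1 : ℝ → ℝ)^[n] ⁻¹' B : Set ℝ) :=
    (iterate_congr T.2.quasiMeasurePreserving h n).preimage B
  refine ⟨B, hBA, hB, ?_, ?_⟩
  · exact h1.trans_eq (measure_congr (h3.diff (Filter.EventuallyEq.refl _ B)))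
  · exact h2.trans_eq (measure_congr ((Filter.EventuallyEq.refl _ B).diff h3))

/-- `S ∈ M(μ)` is anti-periodic. -/
def IsAntiPeriodic : M → Prop :=
  Quotient.lift AntiPeriodic fun _ _ h => propext ⟨fun hT => hT.congr h, fun hS => hS.congr h.symm⟩

/-- `E(T)`: the ergodic `S` such that `T × S` is ergodic. -/
def E (T : M) : Set M := {S | IsErgodic S ∧ ProdErgodic T S}

/-- `ĒC(T)`: the ergodic `S` such that `T × S` is conservative but not ergodic. -/
def EbarC (T : M) : Set M := {S | IsErgodic S ∧ ProdConservative T S ∧ ¬ ProdErgodic T S}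

/-- `C̄(T)`: the ergodic `S` such that `T × S` is not conservative. -/
def Cbar (T : M) : Set M := {S | IsErgodic S ∧ ¬ ProdConservative T S}

end ErgodicCategory

end

open MeasureTheory Set
open scoped symmDiff

noncomputable section

namespace ErgodicCategory

/-! ### Extending almost everywhere defined isomorphisms -/

/-! Density and the `Gδ` property are proved separately.

Density. Conjugating `S` by `R` conjugates `T × S` by `id × R`, so each of the three sets is
invariant under conjugation of `S`. It therefore suffices that the conjugacy class of an
anti-periodic `S` is weakly dense (`AntiPeriodic.dense_conjugates`). Only finitely many sets `D i`,
with union `K`, matter for an approximation. Given a target `T`, take a tower of height `n` for `S`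
and let a map `ψ` copy onto it the `T`-orbit segments that meet `K ∪ T⁻¹ K`. The map `ψ` intertwines
`S` and `T` except at the ends of the tower, and it preserves measure over `K ∪ T⁻¹ K`. Label each
`x` by the `D i` that contain `x` and those that contain `T x`. The labels of `x` and of `ψ x` then
have the same distribution, and since level sets of equal measure are isomorphic, some
measure-preserving `R` carries one labelling to the other. For this `R` the preimages of each `D i`
under `R S R⁻¹` and `T` differ only through the ends of the tower, by measure at most `2 μ(K) / n`.

The `Gδ` property. Ergodicity of an invertible `U` is rewritten as an approximation property: for
`A`, `B` of finite measure, `1_A - 1_B` lies within `|μ A - μ B| + ε` in `L¹` of a coboundary `g - g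
∘ U`, with `g` an integral combination of indicators. If `U` is ergodic, matching parts of `A` with
parts of `B` along orbits produces `g` (`nearCoboundary_of_ergodic`); conversely, coboundaries
integrate to zero over invariant sets, which keeps these from separating `A` from `B`
(`ergodic_of_nearCoboundary`). For fixed `g`, `g ∘ (T × S)` varies continuously in `L¹` with `S`, so
each instance of the property is open in `S`. A countable dense family of sets `A`, `B` and the
values `ε = 1 / (n + 1)` suffice. Ergodicity of `T × S` already contains that of `S`. -/

theorem exists_null_not_countable :
    ∃ Z : Set ℝ, MeasurableSet Z ∧ volume Z = 0 ∧ ¬ Z.Countable := by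
  -- The Liouville numbers are null but residual, and a countable set has residual complement.
  refine ⟨{x | Liouville x}, IsGδ.setOfPred_liouville.measurableSet, volume_setOfPred_liouville,
    fun hc => ?_⟩
  have h1 : {x : ℝ | Liouville x}ᶜ ∈ residual ℝ :=
    residual_of_dense_Gδ hc.isGδ_compl (hc.dense_compl ℝ)
  have h2 : {x : ℝ | Liouville x} ∈ residual ℝ := eventually_residual_liouville
  have h3 := dense_of_mem_residual (Filter.inter_mem h1 h2)
  rw [compl_inter_self] at h3
  exact h3.nonempty.ne_empty rfl

/-- By Lusin–Souslin an injective measurable map on a standard Borel space is an isomorphism onto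
its image, so both sets are identified with the common image. -/
theorem exists_measurableEquiv_of_image_eq {Y : Type*} [MeasurableSpace Y]
    [MeasurableSpace.CountablySeparated Y] {Φ Ψ : ℝ → Y} (hΦ : Measurable Φ) (hΨ : Measurable Ψ)
    {X₁ X₂ : Set ℝ} (h₁ : MeasurableSet X₁) (h₂ : MeasurableSet X₂) (hi₁ : InjOn Φ X₁)
    (hi₂ : InjOn Ψ X₂) (h : Φ '' X₁ = Ψ '' X₂) :
    ∃ e : X₁ ≃ᵐ X₂, ∀ x, Ψ (e x) = Φ x := by
  have key : ∀ {Θ : ℝ → Y} {X : Set ℝ} {Y₀ : Set Y}, Measurable Θ → MeasurableSet X →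
      InjOn Θ X → Θ '' X = Y₀ → ∃ e : X ≃ᵐ Y₀, ∀ x, (e x : Y) = Θ x := by
    intro Θ X Y₀ hΘ hX hi hY
    have := hX.standardBorel
    have he : MeasurableEmbedding (fun x : X => Θ x) :=
      (hΘ.comp measurable_subtype_coe).measurableEmbedding
        fun x y hxy => Subtype.ext (hi x.2 y.2 hxy)
    have hr : range (fun x : X => Θ x) = Y₀ := by
      rw [← hY, image_eq_range]
    subst hr
    exact ⟨he.equivRange, fun x => by simp [MeasurableEmbedding.equivRange_apply]⟩
  obtain ⟨e₁, he₁⟩ := key hΦ h₁ hi₁ rfl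
  obtain ⟨e₂, he₂⟩ := key hΨ h₂ hi₂ h.symm
  refine ⟨e₁.trans e₂.symm, fun x => ?_⟩
  rw [← he₂, ← he₁]
  simp

/-- Uncountable standard Borel spaces are all isomorphic, so the complements can be matched
arbitrarily. In the application they are null. -/
theorem exists_measurableEquiv_extending {X₁ X₂ : Set ℝ} (h₁ : MeasurableSet X₁)
    (h₂ : MeasurableSet X₂) (hc₁ : ¬ X₁ᶜ.Countable) (hc₂ : ¬ X₂ᶜ.Countable) (e : X₁ ≃ᵐ X₂) :
    ∃ R : ℝ ≃ᵐ ℝ, ∀ x : X₁, R x = e x := by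
  classical
  have := h₁.compl.standardBorel
  have := h₂.compl.standardBorel
  let c : (X₁ᶜ : Set ℝ) ≃ᵐ (X₂ᶜ : Set ℝ) := PolishSpace.measurableEquivOfNotCountable hc₁ hc₂
  refine ⟨(MeasurableEquiv.sumCompl h₁).symm.trans
    ((MeasurableEquiv.sumCongr e c).trans (MeasurableEquiv.sumCompl h₂)), fun x => ?_⟩
  have : (MeasurableEquiv.sumCompl h₁).symm (x : ℝ) = Sum.inl x := by
    rw [MeasurableEquiv.symm_apply_eq]
    rfl
  simp only [MeasurableEquiv.trans_apply, this]
  rfl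

/-- Two almost everywhere injective codings of the line with the same distribution differ by a
measure preserving transformation. -/
theorem exists_transformation_of_map_eq {Y : Type*} [MeasurableSpace Y]
    [MeasurableSpace.CountablySeparated Y] {Φ Ψ : ℝ → Y} (hΦ : Measurable Φ) (hΨ : Measurable Ψ)
    {N N' : Set ℝ} (hN : MeasurableSet N) (hN' : MeasurableSet N') (hN0 : volume N = 0)
    (hN0' : volume N' = 0) (hi : InjOn Φ Nᶜ) (hi' : InjOn Ψ N'ᶜ)
    (h : (volume : Measure ℝ).map Φ = (volume : Measure ℝ).map Ψ) :
    ∃ R : Transformation, ∀ᵐ x, Ψ (R.1 x) = Φ x := by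
  -- Deleting `Z` on both sides costs no measure and makes both leftover sets uncountable, as the
  -- extension to the whole line requires.
  obtain ⟨Z, hZ, hZ0, hZc⟩ := exists_null_not_countable
  have hvol : ∀ t, MeasurableSet t → volume (Φ ⁻¹' t) = volume (Ψ ⁻¹' t) := fun t ht => by
    rw [← Measure.map_apply hΦ ht, h, Measure.map_apply hΨ ht]
  have inj₁ : InjOn Φ (N ∪ Z)ᶜ := hi.mono (compl_subset_compl.2 subset_union_left)
  have inj₂ : InjOn Ψ (N' ∪ Z)ᶜ := hi'.mono (compl_subset_compl.2 subset_union_left)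
  have m₁ : MeasurableSet (Φ '' (N ∪ Z)ᶜ) :=
    (hN.union hZ).compl.image_of_measurable_injOn hΦ inj₁
  have m₂ : MeasurableSet (Ψ '' (N' ∪ Z)ᶜ) :=
    (hN'.union hZ).compl.image_of_measurable_injOn hΨ inj₂
  have z₁ : volume (N ∪ Z) = 0 := measure_union_null hN0 hZ0
  have z₂ : volume (N' ∪ Z) = 0 := measure_union_null hN0' hZ0
  have u₁ : volume (Φ ⁻¹' (Φ '' (N ∪ Z)ᶜ))ᶜ = 0 := by
    refine measure_mono_null (fun x hx => ?_) z₁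
    by_contra hx'
    exact hx ⟨x, hx', rfl⟩
  have u₂ : volume (Ψ ⁻¹' (Ψ '' (N' ∪ Z)ᶜ))ᶜ = 0 := by
    refine measure_mono_null (fun x hx => ?_) z₂
    by_contra hx'
    exact hx ⟨x, hx', rfl⟩
  -- Each image has full measure for its own coding, hence for the other one, because the
  -- distributions agree. On the common part both codings can be inverted.
  set Y₀ := Φ '' (N ∪ Z)ᶜ ∩ Ψ '' (N' ∪ Z)ᶜ with hY₀
  have hY₀m : MeasurableSet Y₀ := m₁.inter m₂
  have w₁ : volume (Φ ⁻¹' Y₀)ᶜ = 0 := by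
    rw [hY₀, preimage_inter, compl_inter]
    refine measure_union_null u₁ ?_
    rw [← preimage_compl, hvol _ m₂.compl]
    exact u₂
  have w₂ : volume (Ψ ⁻¹' Y₀)ᶜ = 0 := by
    rw [hY₀, preimage_inter, compl_inter]
    refine measure_union_null ?_ u₂
    rw [← preimage_compl, ← hvol _ m₁.compl]
    exact u₁
  set X₁ := (N ∪ Z)ᶜ ∩ Φ ⁻¹' Y₀ with hX₁
  set X₂ := (N' ∪ Z)ᶜ ∩ Ψ ⁻¹' Y₀ with hX₂
  have hm₁ : MeasurableSet X₁ := (hN.union hZ).compl.inter (hΦ hY₀m)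
  have hm₂ : MeasurableSet X₂ := (hN'.union hZ).compl.inter (hΨ hY₀m)
  have c₁ : volume X₁ᶜ = 0 := by
    rw [hX₁, compl_inter, compl_compl]
    exact measure_union_null z₁ w₁
  have c₂ : volume X₂ᶜ = 0 := by
    rw [hX₂, compl_inter, compl_compl]
    exact measure_union_null z₂ w₂
  have s₁ : Z ⊆ X₁ᶜ := fun x hx hx' => hx'.1 (Or.inr hx)
  have s₂ : Z ⊆ X₂ᶜ := fun x hx hx' => hx'.1 (Or.inr hx)
  have im₁ : Φ '' X₁ = Y₀ := by
    rw [hX₁, image_inter_preimage, inter_eq_right]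
    exact inter_subset_left
  have im₂ : Ψ '' X₂ = Y₀ := by
    rw [hX₂, image_inter_preimage, inter_eq_right]
    exact inter_subset_right
  have ij₂ : InjOn Ψ X₂ := inj₂.mono inter_subset_left
  obtain ⟨e, he⟩ := exists_measurableEquiv_of_image_eq hΦ hΨ hm₁ hm₂
    (inj₁.mono inter_subset_left) ij₂ (im₁.trans im₂.symm)
  obtain ⟨R, hR⟩ := exists_measurableEquiv_extending hm₁ hm₂ (fun hc => hZc (hc.mono s₁))
    (fun hc => hZc (hc.mono s₂)) e
  have hRX : ∀ x ∈ X₁, R x ∈ X₂ ∧ Ψ (R x) = Φ x := by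
    intro x hx
    rw [hR ⟨x, hx⟩]
    exact ⟨(e ⟨x, hx⟩).2, he ⟨x, hx⟩⟩
  have ae₁ : ∀ᵐ x, x ∈ X₁ := mem_ae_iff.2 c₁
  have ae₂ : ∀ᵐ x, x ∈ X₂ := mem_ae_iff.2 c₂
  refine ⟨⟨R, R.measurable, ?_⟩, ?_⟩
  · ext s hs
    rw [Measure.map_apply R.measurable hs]
    have ht : MeasurableSet (Ψ '' (s ∩ X₂)) :=
      (hs.inter hm₂).image_of_measurable_injOn hΨ (ij₂.mono inter_subset_right)
    calc volume (R ⁻¹' s) = volume (Φ ⁻¹' (Ψ '' (s ∩ X₂))) := by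
          refine measure_congr (Filter.eventuallyEq_set.2 ?_)
          filter_upwards [ae₁] with x hx
          obtain ⟨h1, h2⟩ := hRX x hx
          constructor
          · intro h3
            exact ⟨R x, ⟨h3, h1⟩, h2⟩
          · rintro ⟨y, ⟨hy, hy'⟩, hxy⟩
            have : y = R x := ij₂ hy' h1 (hxy.trans h2.symm)
            exact mem_preimage.2 (this ▸ hy)
      _ = volume (Ψ ⁻¹' (Ψ '' (s ∩ X₂))) := hvol _ ht
      _ = volume s := by
          refine measure_congr (Filter.eventuallyEq_set.2 ?_)
          filter_upwards [ae₂] with x hx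
          constructor
          · rintro ⟨y, ⟨hy, hy'⟩, hxy⟩
            exact ij₂ hy' hx hxy ▸ hy
          · intro h3
            exact ⟨x, ⟨h3, hx⟩, rfl⟩
  · filter_upwards [ae₁] with x hx using (hRX x hx).2

/-! ### Ranking the points of a subset of the line -/

/-- The points of `[0, a)`, for an extended non-negative number `a`. -/
def initialInterval (a : ENNReal) : Set ℝ := {y | 0 ≤ y ∧ ENNReal.ofReal y < a}

theorem volume_Iic_inter_initialInterval (a : ENNReal) (y : ℝ) :
    volume (Iic y ∩ initialInterval a) = min (ENNReal.ofReal y) a := by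
  rcases le_or_gt a (ENNReal.ofReal y) with h | h
  · rw [min_eq_right h]
    have ha : a ≠ ⊤ := (h.trans_lt ENNReal.ofReal_lt_top).ne
    lift a to NNReal using ha
    have : Iic y ∩ initialInterval a = Ico 0 (a : ℝ) := by
      ext z
      simp only [initialInterval, mem_inter_iff, mem_Iic, mem_ofPred_eq, mem_Ico]
      constructor
      · rintro ⟨-, h0, h1⟩
        refine ⟨h0, ?_⟩
        rwa [← ENNReal.ofReal_coe_nnreal, ENNReal.ofReal_lt_ofReal_iff_of_nonneg h0] at h1
      · rintro ⟨h0, h1⟩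
        have h2 : ENNReal.ofReal z < a := by
          rwa [← ENNReal.ofReal_coe_nnreal, ENNReal.ofReal_lt_ofReal_iff_of_nonneg h0]
        refine ⟨?_, h0, h2⟩
        by_contra! hy
        exact (h2.trans_le h).not_ge (ENNReal.ofReal_le_ofReal hy.le)
    rw [this]
    simp
  · rw [min_eq_left h.le]
    have : Iic y ∩ initialInterval a = Icc 0 y := by
      ext z
      simp only [initialInterval, mem_inter_iff, mem_Iic, mem_ofPred_eq, mem_Icc]
      constructor
      · rintro ⟨h0, h1, -⟩
        exact ⟨h1, h0⟩
      · rintro ⟨h0, h1⟩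
        exact ⟨h1, h0, (ENNReal.ofReal_le_ofReal h1).trans_lt h⟩
    rw [this]
    simp

/-- Half lines form a π-system and those with integer endpoints exhaust the line, so the total mass
may be infinite. -/
theorem measure_ext_of_Iic_nat {μ ν : Measure ℝ} (hμ : ∀ y : ℝ, μ (Iic y) ≠ ⊤)
    (h : ∀ y : ℝ, μ (Iic y) = ν (Iic y)) : μ = ν := by
  refine Measure.ext_of_generateFrom_of_iUnion (range Iic) (fun n : ℕ => Iic (n : ℝ))
    (by rw [← borel_eq_generateFrom_Iic ℝ]; exact (BorelSpace.measurable_eq (α := ℝ)))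
    isPiSystem_Iic ?_ (fun n => ⟨_, rfl⟩) (fun n => hμ _) ?_
  · refine eq_univ_of_forall fun x => ?_
    obtain ⟨n, hn⟩ := exists_nat_ge x
    exact mem_iUnion.2 ⟨n, hn⟩
  · rintro _ ⟨y, rfl⟩
    exact h y

/-! ### Distribution functions of measures that are finite on lower half lines. -/

section Cumulative

variable {ν : Measure ℝ}

theorem monotone_real_Iic (hf : ∀ x, ν (Iic x) ≠ ⊤) : Monotone fun x => ν.real (Iic x) :=
  fun _ b h => measureReal_mono (Iic_subset_Iic.2 h) (hf b)

theorem ofReal_real_Iic (hf : ∀ x, ν (Iic x) ≠ ⊤) (x : ℝ) :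
    ENNReal.ofReal (ν.real (Iic x)) = ν (Iic x) := ENNReal.ofReal_toReal (hf x)

/-- The distribution function takes each value below the total mass (here as a lower bound for
the mass of a sublevel set). -/
theorem le_measure_sublevel [NullSingletonClass ν] (hf : ∀ x, ν (Iic x) ≠ ⊤) {y : ℝ}
    (hy : ENNReal.ofReal y < ν univ) :
    ENNReal.ofReal y ≤ ν {x | ν.real (Iic x) ≤ y} := by
  set S := {x | ν.real (Iic x) ≤ y} with hS
  rcases le_or_gt y 0 with h0 | h0
  · simp [ENNReal.ofReal_of_nonpos h0]
  have hex : ∃ b, b ∉ S := by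
    by_contra! hall
    have hle : ν univ ≤ ENNReal.ofReal y := by
      have : (univ : Set ℝ) = ⋃ n : ℕ, Iic (n : ℝ) := by
        refine (eq_univ_of_forall fun x => ?_).symm
        obtain ⟨n, hn⟩ := exists_nat_ge x
        exact mem_iUnion.2 ⟨n, hn⟩
      rw [this, Monotone.measure_iUnion
        (fun a b hab => Iic_subset_Iic.2 (Nat.cast_le.2 hab))]
      refine iSup_le fun n => ?_
      rw [← ofReal_real_Iic hf]
      exact ENNReal.ofReal_le_ofReal (hall n)
    exact hle.not_gt hy
  obtain ⟨b, hb⟩ := hex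
  have hlow : ∀ x ∈ S, ∀ z ≤ x, z ∈ S := fun x hx z hz => (monotone_real_Iic hf hz).trans hx
  have hbd : BddAbove S := ⟨b, fun x hx => le_of_not_gt fun hlt => hb (hlow x hx b hlt.le)⟩
  have hmono : ν (Iic (sSup S)) ≤ ν S := by
    rw [measure_congr (Iio_ae_eq_Iic (μ := ν) (a := sSup S)).symm]
    refine measure_mono fun z hz => ?_
    by_cases hne : S.Nonempty
    · obtain ⟨x, hx, hzx⟩ := exists_lt_of_lt_csSup hne hz
      exact hlow x hx z hzx.le
    -- If the sublevel set were empty, all half lines would have mass at least `y > 0`, although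
    -- these masses tend to zero at `-∞`.
    · exfalso
      have hall : ∀ x, ENNReal.ofReal y ≤ ν (Iic x) := fun x => by
        rw [← ofReal_real_Iic hf]
        refine ENNReal.ofReal_le_ofReal ?_
        by_contra! hlt
        exact hne ⟨x, hlt.le⟩
      have hI : ⋂ n : ℕ, Iic (-(n : ℝ)) = ∅ := by
        refine eq_empty_of_forall_notMem fun x hx => ?_
        obtain ⟨n, hn⟩ := exists_nat_gt (-x)
        have := mem_iInter.1 hx n
        simp only [mem_Iic] at this
        linarith
      have ht := tendsto_measure_iInter_atTop (μ := ν) (s := fun n : ℕ => Iic (-(n : ℝ)))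
        (fun n => measurableSet_Iic.nullMeasurableSet)
        (fun a c hac => Iic_subset_Iic.2 (neg_le_neg (Nat.cast_le.2 hac))) ⟨0, hf _⟩
      rw [hI, measure_empty] at ht
      have := ge_of_tendsto' ht fun n : ℕ => hall (-(n : ℝ))
      simp only [nonpos_iff_eq_zero, ENNReal.ofReal_eq_zero] at this
      linarith
  refine le_trans ?_ hmono
  -- Continuity from the right at the supremum: every point beyond it has a half line of mass more
  -- than `y`.
  have hinter : Iic (sSup S) = ⋂ n : ℕ, Iic (sSup S + 1 / ((n : ℝ) + 1)) := by
    ext z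
    simp only [mem_Iic, mem_iInter]
    refine ⟨fun hz n => hz.trans (le_add_of_nonneg_right (by positivity)), fun hz => ?_⟩
    refine le_of_forall_pos_lt_add fun ε hε => ?_
    obtain ⟨n, hn⟩ := exists_nat_one_div_lt hε
    linarith [hz n]
  have ht := tendsto_measure_iInter_atTop (μ := ν)
    (s := fun n : ℕ => Iic (sSup S + 1 / ((n : ℝ) + 1)))
    (fun n => measurableSet_Iic.nullMeasurableSet)
    (fun a c hac => Iic_subset_Iic.2 (by gcongr)) ⟨0, hf _⟩
  rw [← hinter] at ht
  refine ge_of_tendsto' ht fun n => ?_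
  rw [Function.comp_apply, ← ofReal_real_Iic hf]
  refine ENNReal.ofReal_le_ofReal ?_
  by_contra! hlt
  have h1 : sSup S + 1 / ((n : ℝ) + 1) ≤ sSup S := le_csSup hbd (show _ ∈ S from hlt.le)
  have h2 : 0 < 1 / ((n : ℝ) + 1) := by positivity
  linarith

/-- The sublevel set is covered by countably many nested half lines `Iic a` with `a` in it, and each
of them has mass at most `y`. -/
theorem measure_sublevel_le (hf : ∀ x, ν (Iic x) ≠ ⊤) (y : ℝ) :
    ν {x | ν.real (Iic x) ≤ y} ≤ ENNReal.ofReal y := by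
  set S := {x | ν.real (Iic x) ≤ y} with hS
  obtain ⟨t, htS, htc, ht⟩ : ∃ t ⊆ S, t.Countable ∧ S ⊆ ⋃ a ∈ t, Iic a := by
    by_cases hmax : ∃ m ∈ S, ∀ x ∈ S, x ≤ m
    · obtain ⟨m, hm, hx⟩ := hmax
      exact ⟨{m}, by simpa using hm, countable_singleton m, fun x h => by simpa using hx x h⟩
    · push Not at hmax
      refine ⟨S ∩ range ((↑) : ℚ → ℝ), inter_subset_left,
        (countable_range _).mono inter_subset_right, fun x hx => ?_⟩
      obtain ⟨x', hx', hlt⟩ := hmax x hx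
      obtain ⟨q, hq, hq'⟩ := exists_rat_btwn hlt
      refine mem_biUnion (x := (q : ℝ)) ⟨?_, q, rfl⟩ hq.le
      exact (monotone_real_Iic hf hq'.le).trans hx'
  refine (measure_mono ht).trans ?_
  rw [measure_biUnion_eq_iSup htc]
  · refine iSup₂_le fun a ha => ?_
    rw [← ofReal_real_Iic hf]
    exact ENNReal.ofReal_le_ofReal (htS ha)
  · intro a ha c hc
    rcases le_total a c with h | h
    · exact ⟨c, hc, Iic_subset_Iic.2 h, Subset.rfl⟩
    · exact ⟨a, ha, Subset.rfl, Iic_subset_Iic.2 h⟩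

/-- The distribution function of a measure without atoms is uniformly distributed. -/
theorem map_real_Iic [NullSingletonClass ν] (hf : ∀ x, ν (Iic x) ≠ ⊤) :
    ν.map (fun x => ν.real (Iic x)) = volume.restrict (initialInterval (ν univ)) := by
  have hm : Measurable fun x => ν.real (Iic x) := (monotone_real_Iic hf).measurable
  have hval : ∀ y, ν.map (fun x => ν.real (Iic x)) (Iic y) = min (ENNReal.ofReal y) (ν univ) := by
    intro y
    rw [Measure.map_apply hm measurableSet_Iic]
    change ν {x | ν.real (Iic x) ≤ y} = _
    refine le_antisymm (le_min (measure_sublevel_le hf y) (measure_mono (subset_univ _))) ?_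
    rcases le_or_gt y 0 with h0 | h0
    · simp [ENNReal.ofReal_of_nonpos h0]
    rcases lt_or_ge (ENNReal.ofReal y) (ν univ) with h | h
    · exact (min_le_left _ _).trans (le_measure_sublevel hf h)
    · refine (min_le_right _ _).trans (measure_mono fun x _ => ?_)
      exact ENNReal.toReal_le_of_le_ofReal h0.le ((measure_mono (subset_univ _)).trans h)
  refine measure_ext_of_Iic_nat (fun y => ?_) fun y => ?_
  · rw [hval]
    exact (min_le_left _ _).trans_lt ENNReal.ofReal_lt_top |>.ne
  · rw [hval, Measure.restrict_apply measurableSet_Iic, volume_Iic_inter_initialInterval]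

/-- A value taken at two points is taken on the whole interval between them, hence at a rational.
The values at rationals are thus the only ones to exclude. -/
theorem exists_countable_injOn_real_Iic (hf : ∀ x, ν (Iic x) ≠ ⊤) :
    ∃ C : Set ℝ, C.Countable ∧ InjOn (fun x => ν.real (Iic x))
      ((fun x => ν.real (Iic x)) ⁻¹' Cᶜ) := by
  refine ⟨range fun q : ℚ => ν.real (Iic (q : ℝ)), countable_range _, ?_⟩
  have key : ∀ x z : ℝ, ν.real (Iic x) ∉ (range fun q : ℚ => ν.real (Iic (q : ℝ))) →
      ν.real (Iic x) = ν.real (Iic z) → ¬ x < z := by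
    intro x z hx hxz hlt
    obtain ⟨q, hq, hq'⟩ := exists_rat_btwn hlt
    refine hx ⟨q, le_antisymm ?_ (monotone_real_Iic hf hq.le)⟩
    exact (monotone_real_Iic hf hq'.le).trans hxz.ge
  intro x hx z hz hxz
  exact le_antisymm (not_lt.1 (key z x hz hxz.symm)) (not_lt.1 (key x z hx hxz))

end Cumulative

/-- An injection of the line into the half line that has small sublevel sets. -/
def fold (x : ℝ) : ℝ := (Encodable.encode ⌊x⌋ : ℝ) + Int.fract x

theorem measurable_fold : Measurable fold :=
  ((measurable_from_top (f := fun k : ℤ => ((Encodable.encode k : ℕ) : ℝ))).comp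
    Int.measurable_floor).add measurable_fract

theorem floor_fold (x : ℝ) : ⌊fold x⌋ = (Encodable.encode ⌊x⌋ : ℤ) := by
  rw [Int.floor_eq_iff]
  unfold fold
  push_cast
  exact ⟨by linarith [Int.fract_nonneg x], by linarith [Int.fract_lt_one x]⟩

theorem fold_injective : Function.Injective fold := by
  intro x y h
  have h1 : ⌊x⌋ = ⌊y⌋ := by
    have := (floor_fold x).symm.trans ((congrArg Int.floor h).trans (floor_fold y))
    exact Encodable.encode_injective (by exact_mod_cast this)
  have h2 : Int.fract x = Int.fract y := by
    unfold fold at h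
    rw [h1] at h
    linarith
  rw [← Int.floor_add_fract x, ← Int.floor_add_fract y, h1, h2]

/-- Only finitely many unit intervals have a code of size at most `y`. This gives a finite
distribution function even to sets of infinite measure near `-∞`. -/
theorem volume_fold_preimage_Iic_ne_top (y : ℝ) : volume (fold ⁻¹' Iic y) ≠ ⊤ := by
  have hfin : {k : ℤ | (Encodable.encode k : ℕ) ≤ ⌊y⌋₊}.Finite :=
    (finite_Iic ⌊y⌋₊).preimage (Encodable.encode_injective.injOn)
  have hsub : fold ⁻¹' Iic y ⊆ ⋃ k ∈ hfin.toFinset, Ico (k : ℝ) (k + 1) := by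
    intro x hx
    simp only [mem_iUnion, Finite.mem_toFinset]
    refine ⟨⌊x⌋, ?_, Int.floor_le x, Int.lt_floor_add_one x⟩
    refine Nat.le_floor ?_
    have h1 : fold x ≤ y := hx
    unfold fold at h1
    linarith [Int.fract_nonneg x]
  refine ((measure_mono hsub).trans_lt ((measure_biUnion_finset_le _ _).trans_lt ?_)).ne
  exact ENNReal.sum_lt_top.2 fun k _ => by simp

/-- Every subset of the line is isomorphic to an initial interval, up to null sets. -/
theorem exists_rank (A : Set ℝ) :
    ∃ F : ℝ → ℝ, Measurable F ∧
      (volume.restrict A).map F = volume.restrict (initialInterval (volume A)) ∧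
      ∃ C : Set ℝ, C.Countable ∧ InjOn F (F ⁻¹' Cᶜ) := by
  -- The rank of `x` is the amount of `A` that comes no later than `x` in the order of the folded
  -- line.
  set ν := (volume.restrict A).map fold with hν
  have hf : ∀ x, ν (Iic x) ≠ ⊤ := fun x => by
    rw [hν, Measure.map_apply measurable_fold measurableSet_Iic]
    exact ((Measure.restrict_apply_le _ _).trans_lt
      (volume_fold_preimage_Iic_ne_top x).lt_top).ne
  have : NullSingletonClass ν := ⟨fun y => by
    rw [hν, Measure.map_apply measurable_fold (measurableSet_singleton y)]
    exact (subsingleton_singleton.preimage fold_injective).measure_zero _⟩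
  have hu : ν univ = volume A := by
    rw [hν, Measure.map_apply measurable_fold MeasurableSet.univ]
    simp
  have hm : Measurable fun x => ν.real (Iic x) := (monotone_real_Iic hf).measurable
  obtain ⟨C, hC, hi⟩ := exists_countable_injOn_real_Iic hf
  refine ⟨fun x => ν.real (Iic (fold x)), hm.comp measurable_fold, ?_, C, hC, ?_⟩
  · rw [← hu, ← map_real_Iic hf, hν, Measure.map_map (by rw [← hν]; exact hm) measurable_fold]
    rfl
  · intro x hx y hy hxy
    exact fold_injective (hi hx hy hxy)

/-! ### Subsets, samplings and labellings with prescribed measures -/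

/-- Take the points of `A` of rank at most `m`. -/
theorem exists_subset_volume_eq {A : Set ℝ} (hA : MeasurableSet A) {m : ENNReal} (hm : m ≠ ⊤)
    (h : m ≤ volume A) : ∃ B ⊆ A, MeasurableSet B ∧ volume B = m := by
  obtain ⟨F, hF, hmap, -⟩ := exists_rank A
  refine ⟨F ⁻¹' Iic m.toReal ∩ A, inter_subset_right, (hF measurableSet_Iic).inter hA, ?_⟩
  rw [← Measure.restrict_apply (hF measurableSet_Iic), ← Measure.map_apply hF measurableSet_Iic,
    hmap, Measure.restrict_apply measurableSet_Iic, volume_Iic_inter_initialInterval,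
    ENNReal.ofReal_toReal hm, min_eq_left h]

theorem measure_preimage_countable_eq_zero {μ : Measure ℝ} {F : ℝ → ℝ} (hF : Measurable F)
    {s : Set ℝ} (h : μ.map F = volume.restrict s) {C : Set ℝ} (hC : C.Countable) :
    μ (F ⁻¹' C) = 0 := by
  rw [← Measure.map_apply hF hC.measurableSet, h]
  exact le_antisymm ((Measure.restrict_apply_le _ _).trans (hC.measure_zero _).le) zero_le

/-- The rank is injective off a null set of `W`, and `G` is a measurable inverse of it there. -/
theorem exists_sampling (W : Set ℝ) :
    ∃ G : ℝ → ℝ, Measurable G ∧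
      (volume.restrict (initialInterval (volume W))).map G = volume.restrict W := by
  obtain ⟨F, hF, hmap, C, hC, hi⟩ := exists_rank W
  have hX : MeasurableSet (F ⁻¹' Cᶜ) := hF hC.measurableSet.compl
  have := hX.standardBorel
  have he : MeasurableEmbedding (fun x : (F ⁻¹' Cᶜ) => F x) :=
    (hF.comp measurable_subtype_coe).measurableEmbedding
      fun x y hxy => Subtype.ext (hi x.2 y.2 hxy)
  obtain ⟨G, hG, hGF⟩ := he.exists_measurable_extend measurable_subtype_coe fun _ => ⟨(0 : ℝ)⟩
  refine ⟨G, hG, ?_⟩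
  rw [← hmap, Measure.map_map hG hF]
  have hae : G ∘ F =ᵐ[volume.restrict W] id := by
    have h0 : ∀ᵐ x ∂(volume.restrict W), x ∈ F ⁻¹' Cᶜ := by
      rw [ae_iff]
      refine measure_mono_null (fun x hx => ?_) (measure_preimage_countable_eq_zero hF hmap hC)
      exact not_not.1 hx
    filter_upwards [h0] with x hx
    exact congrFun hGF ⟨x, hx⟩
  rw [Measure.map_congr hae, Measure.map_id]

theorem preimage_mul_initialInterval {c : ℝ} (hc : 0 < c) (a : ENNReal) :
    (fun y => c * y) ⁻¹' initialInterval (ENNReal.ofReal c * a) = initialInterval a := by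
  ext y
  simp only [initialInterval, mem_preimage, mem_ofPred_eq]
  rw [mul_nonneg_iff_of_pos_left hc, ENNReal.ofReal_mul hc.le,
    ENNReal.mul_lt_mul_iff_right (by simpa using hc) ENNReal.ofReal_ne_top]

/-- A set can be spread uniformly over a set that is `n` times as large. -/
theorem exists_spreading {B : Set ℝ} (W : Set ℝ) {n : ℕ} (hn : n ≠ 0)
    (h : n * volume B = volume W) :
    ∃ φ : ℝ → ℝ, Measurable φ ∧ ∀ s, MeasurableSet s →
      n * volume (φ ⁻¹' s ∩ B) = volume (s ∩ W) := by
  obtain ⟨F, hF, hmap, -⟩ := exists_rank B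
  obtain ⟨G, hG, hGmap⟩ := exists_sampling W
  have hn0 : (0 : ℝ) < n := by positivity
  -- The spreading map takes the rank in `B`, stretches it by the factor `n`, and samples `W` at the
  -- result.
  have hc : Measurable fun y : ℝ => (n : ℝ) * y := measurable_const_mul _
  refine ⟨fun x => G (n * F x), hG.comp (hc.comp hF), fun s hs => ?_⟩
  have hm : Measurable fun x => G (n * F x) := hG.comp (hc.comp hF)
  have e1 : volume ((fun x => G (n * F x)) ⁻¹' s ∩ B) =
      volume ((fun y => (n : ℝ) * y) ⁻¹' (G ⁻¹' s ∩ initialInterval (volume W))) := by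
    rw [← Measure.restrict_apply (hm hs)]
    change volume.restrict B (F ⁻¹' ((fun y => (n : ℝ) * y) ⁻¹' (G ⁻¹' s))) = _
    rw [← Measure.map_apply hF (hc (hG hs)), hmap, Measure.restrict_apply (hc (hG hs)),
      preimage_inter, ← h, ← preimage_mul_initialInterval hn0 (volume B), ENNReal.ofReal_natCast]
  rw [e1, Real.volume_preimage_mul_left hn0.ne', ← Measure.restrict_apply (hG hs),
    ← Measure.map_apply hG hs, hGmap, Measure.restrict_apply hs, ← mul_assoc,
    abs_of_pos (inv_pos.2 hn0), ENNReal.ofReal_inv_of_pos hn0, ENNReal.ofReal_natCast,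
    ENNReal.mul_inv_cancel (by exact_mod_cast hn) (ENNReal.natCast_ne_top n), one_mul]

/-- A point is coded by its label and its rank within the level set of that label. The distribution
of this code depends only on the measures of the level sets, so labellings can be compared through
it. -/
theorem exists_label_coding {Λ : Type*} [Countable Λ] [MeasurableSpace Λ]
    [MeasurableSingletonClass Λ] {f : ℝ → Λ} (hf : Measurable f) :
    ∃ Φ : ℝ → Λ × ℝ, Measurable Φ ∧ (∀ x, (Φ x).1 = f x) ∧
      (∃ N, MeasurableSet N ∧ volume N = 0 ∧ InjOn Φ Nᶜ) ∧
      ∀ s, MeasurableSet s → volume (Φ ⁻¹' s) =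
        ∑' e, volume.restrict (initialInterval (volume (f ⁻¹' {e}))) ((fun y => (e, y)) ⁻¹' s) := by
  choose F hF hmap C hC hi using fun e => exists_rank (f ⁻¹' {e})
  have hΦ : Measurable fun x => (f x, F (f x) x) :=
    hf.prodMk ((measurable_from_prod_countable_right (f := fun p : Λ × ℝ => F p.1 p.2) hF).comp
      (hf.prodMk measurable_id))
  have hfe : ∀ e, MeasurableSet (f ⁻¹' {e}) := fun e => hf (measurableSet_singleton e)
  refine ⟨fun x => (f x, F (f x) x), hΦ, fun _ => rfl,
    ⟨⋃ e, (F e ⁻¹' C e ∩ f ⁻¹' {e}), ?_, ?_, ?_⟩, ?_⟩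
  · exact MeasurableSet.iUnion fun e => (hF e (hC e).measurableSet).inter (hfe e)
  · refine measure_iUnion_null fun e => ?_
    rw [← Measure.restrict_apply (hF e (hC e).measurableSet)]
    exact measure_preimage_countable_eq_zero (hF e) (hmap e) (hC e)
  · intro x hx y hy hxy
    obtain ⟨h1, h2⟩ := Prod.ext_iff.1 hxy
    simp only at h1 h2
    rw [← h1] at h2
    refine hi (f x) (fun h => hx ?_) (fun h => hy ?_) h2
    · exact mem_iUnion.2 ⟨f x, h, rfl⟩
    · exact mem_iUnion.2 ⟨f x, h, h1.symm⟩
  · intro s hs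
    have hse : ∀ e, MeasurableSet ((fun y : ℝ => (e, y)) ⁻¹' s) := fun e =>
      measurable_prodMk_left hs
    have hdec : (fun x => (f x, F (f x) x)) ⁻¹' s =
        ⋃ e, (F e ⁻¹' ((fun y => (e, y)) ⁻¹' s) ∩ f ⁻¹' {e}) := by
      ext x
      simp only [mem_preimage, mem_iUnion, mem_inter_iff, mem_singleton_iff]
      constructor
      · intro h
        exact ⟨f x, h, rfl⟩
      · rintro ⟨e, h, rfl⟩
        exact h
    rw [hdec, measure_iUnion]
    · refine tsum_congr fun e => ?_
      rw [← hmap e, Measure.map_apply (hF e) (hse e), Measure.restrict_apply (hF e (hse e))]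
    · intro a b hab
      refine disjoint_left.2 fun x hx hx' => hab ?_
      exact hx.2.symm.trans hx'.2
    · exact fun e => (hF e (hse e)).inter (hfe e)

/-- Two labellings with the same distribution differ by a measure preserving transformation. -/
theorem exists_transformation_of_label {Λ : Type*} [Countable Λ] [MeasurableSpace Λ]
    [MeasurableSingletonClass Λ] {f g : ℝ → Λ} (hf : Measurable f) (hg : Measurable g)
    (h : ∀ e, volume (f ⁻¹' {e}) = volume (g ⁻¹' {e})) :
    ∃ R : Transformation, ∀ᵐ x, g (R.1 x) = f x := by
  obtain ⟨Φ, hΦ, hΦf, ⟨N, hN, hN0, hi⟩, hs⟩ := exists_label_coding hf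
  obtain ⟨Ψ, hΨ, hΨg, ⟨N', hN', hN0', hi'⟩, hs'⟩ := exists_label_coding hg
  obtain ⟨R, hR⟩ := exists_transformation_of_map_eq hΦ hΨ hN hN' hN0 hN0' hi hi' (by
    ext s hm
    rw [Measure.map_apply hΦ hm, Measure.map_apply hΨ hm, hs s hm, hs' s hm]
    simp only [h])
  refine ⟨R, ?_⟩
  filter_upwards [hR] with x hx
  rw [← hΨg, ← hΦf, hx]

/-! ### Towers -/

/-- The first `n` images of `B` are pairwise disjoint. -/
def IsTowerBase (T : ℝ ≃ᵐ ℝ) (n : ℕ) (B : Set ℝ) : Prop :=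
  ∀ k, 1 ≤ k → k < n → ∀ x ∈ B, T^[k] x ∉ B

theorem symm_iterate_iterate (T : ℝ ≃ᵐ ℝ) (k : ℕ) (x : ℝ) : T.symm^[k] (T^[k] x) = x :=
  Function.LeftInverse.iterate T.symm_apply_apply k x

theorem iterate_symm_iterate (T : ℝ ≃ᵐ ℝ) (k : ℕ) (x : ℝ) : T^[k] (T.symm^[k] x) = x :=
  Function.LeftInverse.iterate T.apply_symm_apply k x

/-- From each basic open set remove the points that return to it before time `n`. A point that
differs from its next `n - 1` images has a basic neighbourhood that avoids them all. -/
theorem exists_cover_isTowerBase (T : ℝ ≃ᵐ ℝ) (n : ℕ) :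
    ∃ C : ℕ → Set ℝ, (∀ j, MeasurableSet (C j)) ∧ (∀ j, IsTowerBase T n (C j)) ∧
      ∀ x, (∀ k, 1 ≤ k → k < n → T^[k] x ≠ x) → ∃ j, x ∈ C j := by
  obtain ⟨b, hbc, -, hb⟩ := TopologicalSpace.exists_countable_basis ℝ
  obtain ⟨D, rfl⟩ := hbc.exists_eq_range (by
    obtain ⟨s, hs, -⟩ := hb.exists_subset_of_mem_open (mem_univ (0 : ℝ)) isOpen_univ
    exact ⟨s, hs⟩)
  have hDm : ∀ j, MeasurableSet (D j) := fun j => (hb.isOpen ⟨j, rfl⟩).measurableSet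
  refine ⟨fun j => D j \ ⋃ k ∈ Finset.Ico 1 n, T^[k] ⁻¹' D j, fun j => ?_, fun j => ?_, ?_⟩
  · exact (hDm j).diff (Finset.measurableSet_biUnion _ fun k _ =>
      (T.measurable.iterate k) (hDm j))
  · intro k hk hkn x hx hx'
    refine hx.2 (mem_biUnion (x := k) ?_ hx'.1)
    simpa using ⟨hk, hkn⟩
  · intro x hx
    have hfin : (⋃ k ∈ Finset.Ico 1 n, {T^[k] x}).Finite :=
      (Finset.Ico 1 n).finite_toSet.biUnion fun k _ => finite_singleton _
    obtain ⟨_, ⟨j, rfl⟩, hxj, hsub⟩ := hb.exists_subset_of_mem_open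
      (show x ∈ (⋃ k ∈ Finset.Ico 1 n, {T^[k] x})ᶜ by
        simp only [mem_compl_iff, mem_iUnion, not_exists, Finset.mem_Ico, mem_singleton_iff]
        exact fun k hk h => hx k hk.1 hk.2 h.symm) hfin.isClosed.isOpen_compl
    refine ⟨j, hxj, fun h => ?_⟩
    simp only [mem_iUnion, mem_preimage] at h
    obtain ⟨k, hk, hk'⟩ := h
    exact hsub hk' (mem_biUnion (show k ∈ (Finset.Ico 1 n : Finset ℕ) from hk) rfl)

/-- The points whose orbit meets `B` at some time of absolute value less than `n`. -/
def orbitHull (T : ℝ ≃ᵐ ℝ) (n : ℕ) (B : Set ℝ) : Set ℝ :=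
  ⋃ k ∈ Finset.range n, (T^[k] ⁻¹' B ∪ T.symm^[k] ⁻¹' B)

theorem mem_orbitHull {T : ℝ ≃ᵐ ℝ} {n : ℕ} {B : Set ℝ} {x : ℝ} :
    x ∈ orbitHull T n B ↔ ∃ k < n, T^[k] x ∈ B ∨ T.symm^[k] x ∈ B := by
  simp [orbitHull]

theorem measurableSet_orbitHull (T : ℝ ≃ᵐ ℝ) (n : ℕ) {B : Set ℝ} (hB : MeasurableSet B) :
    MeasurableSet (orbitHull T n B) :=
  Finset.measurableSet_biUnion _ fun k _ =>
    ((T.measurable.iterate k) hB).union ((T.symm.measurable.iterate k) hB)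

/-- Greedy enlargement of a tower base. -/
def greedyBase (T : ℝ ≃ᵐ ℝ) (n : ℕ) (C : ℕ → Set ℝ) : ℕ → Set ℝ
  | 0 => ∅
  | j + 1 => greedyBase T n C j ∪ (C j \ orbitHull T n (greedyBase T n C j))

theorem measurableSet_greedyBase (T : ℝ ≃ᵐ ℝ) (n : ℕ) {C : ℕ → Set ℝ}
    (hC : ∀ j, MeasurableSet (C j)) (j : ℕ) : MeasurableSet (greedyBase T n C j) := by
  induction j with
  | zero => exact MeasurableSet.empty
  | succ j ih => exact ih.union ((hC j).diff (measurableSet_orbitHull T n ih))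

/-- New points are taken outside the two-sided hull of the old base, so no return between old and
new points is possible in either direction. -/
theorem isTowerBase_greedyBase (T : ℝ ≃ᵐ ℝ) (n : ℕ) {C : ℕ → Set ℝ}
    (hC : ∀ j, IsTowerBase T n (C j)) (j : ℕ) : IsTowerBase T n (greedyBase T n C j) := by
  induction j with
  | zero => exact fun k _ _ x hx => hx.elim
  | succ j ih =>
    rintro k hk hkn x (hx | hx) (hx' | hx')
    · exact ih k hk hkn x hx hx'
    · refine hx'.2 (mem_orbitHull.2 ⟨k, hkn, Or.inr ?_⟩)
      rwa [symm_iterate_iterate]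
    · exact hx.2 (mem_orbitHull.2 ⟨k, hkn, Or.inl hx'⟩)
    · exact hC j k hk hkn x hx.1 hx'.1

theorem monotone_greedyBase (T : ℝ ≃ᵐ ℝ) (n : ℕ) (C : ℕ → Set ℝ) :
    Monotone (greedyBase T n C) :=
  monotone_nat_of_le_succ fun _ => subset_union_left

/-- Any set `B` of fixed points of `T^k` lies in its preimage under `T^k`, so `B` minus that
preimage is empty, against anti-periodicity. -/
theorem AntiPeriodic.ae_iterate_ne {T : Transformation} (hT : AntiPeriodic T) {k : ℕ}
    (hk : 1 ≤ k) : ∀ᵐ x, T.1^[k] x ≠ x := by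
  have hm : MeasurableSet {x | T.1^[k] x = x} :=
    measurableSet_eq_fun (T.1.measurable.iterate k) measurable_id
  rw [ae_iff]
  simp only [ne_eq, not_not]
  by_contra h
  obtain ⟨B, hBA, -, -, hB⟩ := hT k hk _ hm (pos_iff_ne_zero.2 h)
  refine hB.ne' ?_
  convert measure_empty (μ := (volume : Measure ℝ))
  refine sdiff_eq_empty.2 fun x hx => ?_
  have : T.1^[k] x = x := hBA hx
  rwa [mem_preimage, this]

theorem measurePreserving_symm (T : Transformation) : MeasurePreserving T.1.symm volume volume :=
  T.2.symm T.1

/-- Anti-periodic transformations have towers of any height and any finite size. -/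
theorem AntiPeriodic.exists_isTowerBase {T : Transformation} (hT : AntiPeriodic T) {n : ℕ}
    (hn : n ≠ 0) {m : ENNReal} (hm : m ≠ ⊤) :
    ∃ B, MeasurableSet B ∧ IsTowerBase T.1 n B ∧ volume B = m := by
  obtain ⟨C, hCm, hCt, hC⟩ := exists_cover_isTowerBase T.1 n
  set B := ⋃ j, greedyBase T.1 n C j with hB
  have hBm : MeasurableSet B := MeasurableSet.iUnion (measurableSet_greedyBase T.1 n hCm)
  have hBt : IsTowerBase T.1 n B := by
    intro k hk hkn x hx hx'
    obtain ⟨i, hi⟩ := mem_iUnion.1 hx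
    obtain ⟨j, hj⟩ := mem_iUnion.1 hx'
    exact isTowerBase_greedyBase T.1 n hCt (max i j) k hk hkn x
      (monotone_greedyBase T.1 n C (le_max_left i j) hi)
      (monotone_greedyBase T.1 n C (le_max_right i j) hj)
  -- An aperiodic point lies in some `C j`; either it is in the hull already at stage `j`, or it is
  -- added to the base at stage `j + 1`.
  have hcov : ∀ᵐ x, x ∈ orbitHull T.1 n B := by
    have h1 : ∀ᵐ x, ∀ k, 1 ≤ k → T.1^[k] x ≠ x := by
      rw [ae_all_iff]
      intro k
      by_cases hk : 1 ≤ k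
      · filter_upwards [hT.ae_iterate_ne hk] with x hx _ using hx
      · exact Filter.Eventually.of_forall fun x h => absurd h hk
    filter_upwards [h1] with x hx
    obtain ⟨j, hj⟩ := hC x fun k hk _ => hx k hk
    by_cases hh : x ∈ orbitHull T.1 n (greedyBase T.1 n C j)
    · obtain ⟨k, hk, h2⟩ := mem_orbitHull.1 hh
      exact mem_orbitHull.2 ⟨k, hk, h2.imp (fun h => mem_iUnion.2 ⟨j, h⟩)
        fun h => mem_iUnion.2 ⟨j, h⟩⟩
    · exact mem_orbitHull.2 ⟨0, Nat.pos_of_ne_zero hn,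
        Or.inl (mem_iUnion.2 ⟨j + 1, Or.inr ⟨hj, hh⟩⟩)⟩
  -- The hull is a finite union of translates of `B` and covers almost all of the line. Subsets of a
  -- tower base are again tower bases, so every finite measure is attained.
  have htop : volume B = ⊤ := by
    by_contra hfin
    have h1 : volume (orbitHull T.1 n B) < ⊤ := by
      refine (measure_biUnion_finset_le _ _).trans_lt (ENNReal.sum_lt_top.2 fun k _ => ?_)
      refine measure_union_lt_top ?_ ?_
      · rw [(T.2.iterate k).measure_preimage hBm.nullMeasurableSet]
        exact lt_top_iff_ne_top.2 hfin
      · rw [((measurePreserving_symm T).iterate k).measure_preimage hBm.nullMeasurableSet]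
        exact lt_top_iff_ne_top.2 hfin
    have h2 : orbitHull T.1 n B =ᵐ[volume] univ := Filter.eventuallyEq_univ.2 hcov
    rw [measure_congr h2, Real.volume_univ] at h1
    exact lt_irrefl _ h1
  obtain ⟨B', hB', hB'm, hv⟩ := exists_subset_volume_eq hBm hm (htop ▸ le_top)
  exact ⟨B', hB'm, fun k hk hkn x hx hx' => hBt k hk hkn x (hB' hx) (hB' hx'), hv⟩

/-! ### Conjugacy classes of anti-periodic transformations are dense -/

/-- The conjugate `R S R⁻¹`. -/
def conjugate (R S : Transformation) : Transformation :=
  ⟨R.1.symm.trans (S.1.trans R.1), (R.2.comp S.2).comp (measurePreserving_symm R)⟩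

/-- A tower of the anti-periodic `S` that copies the orbits of `T` through a set `K'`: `ψ` maps the
tower to the orbits and preserves the measure of the subsets of `K'`. -/
theorem AntiPeriodic.exists_tower_copy {S : Transformation} (hS : AntiPeriodic S)
    (T : Transformation) {K' : Set ℝ} (hK' : MeasurableSet K') (hK'fin : volume K' ≠ ⊤)
    {n : ℕ} (hn : n ≠ 0) :
    ∃ (B : Set ℝ) (φ ψ : ℝ → ℝ) (p : ℝ), MeasurableSet B ∧ Measurable φ ∧ Measurable ψ ∧ p ∉ K' ∧
      (∀ s, MeasurableSet s → n * volume (φ ⁻¹' s ∩ B) ≤ volume s) ∧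
      (∀ i < n, ∀ y ∈ B, ψ (S.1^[i] y) = T.1^[i] (φ y)) ∧
      (∀ x, (∀ i < n, S.1.symm^[i] x ∉ B) → ψ x = p) ∧
      ∀ s ⊆ K', MeasurableSet s → volume (ψ ⁻¹' s) = volume s := by
  -- `W` is the set of starting points of `T`-orbit segments of length `n` that meet `K'`. A base of
  -- measure `μ(W) / n` lets `φ` spread it over `W` with factor `n`.
  set W := ⋃ i ∈ Finset.range n, T.1^[i] ⁻¹' K' with hW
  have hWfin : volume W ≠ ⊤ := by
    refine ((measure_biUnion_finset_le _ _).trans_lt (ENNReal.sum_lt_top.2 fun i _ => ?_)).ne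
    rw [(T.2.iterate i).measure_preimage hK'.nullMeasurableSet]
    exact lt_top_iff_ne_top.2 hK'fin
  have hn0 : (n : ENNReal) ≠ 0 := by exact_mod_cast hn
  have hnt : (n : ENNReal) ≠ ⊤ := ENNReal.natCast_ne_top n
  obtain ⟨B, hB, hBt, hBv⟩ := hS.exists_isTowerBase hn
    (m := volume W / n) (ENNReal.div_ne_top hWfin hn0)
  obtain ⟨φ, hφ, hφW⟩ := exists_spreading W hn (by rw [hBv, ENNReal.mul_div_cancel hn0 hnt])
  obtain ⟨p, hp⟩ : ∃ p, p ∉ K' := by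
    by_contra! h
    rw [eq_univ_of_forall h, Real.volume_univ] at hK'fin
    exact hK'fin rfl
  have hLm : ∀ i, MeasurableSet (S.1.symm^[i] ⁻¹' B) := fun i => (S.1.symm.measurable.iterate i) hB
  have hdisj : ∀ i < n, ∀ j < n, ∀ x, S.1.symm^[i] x ∈ B → S.1.symm^[j] x ∈ B → i = j := by
    have key : ∀ i < n, ∀ j < n, ∀ x, S.1.symm^[i] x ∈ B → S.1.symm^[j] x ∈ B → ¬ i < j := by
      intro i hi j hj x hxi hxj hij
      refine hBt (j - i) (by omega) (by omega) _ hxj ?_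
      have : S.1.symm^[j] x = S.1.symm^[j - i] (S.1.symm^[i] x) := by
        rw [← Function.iterate_add_apply]
        congr 2
        omega
      rwa [this, iterate_symm_iterate]
    intro i hi j hj x hxi hxj
    exact le_antisymm (not_lt.1 (key j hj i hi x hxj hxi)) (not_lt.1 (key i hi j hj x hxi hxj))
  -- Floor `i` of the tower is mapped by `S^i y ↦ T^i (φ y)`. Points off the tower go to `p`,
  -- outside `K'`, and so never contribute to preimages of subsets of `K'`.
  obtain ⟨ψ, hψ, hψt⟩ := exists_measurable_piecewise (ι := Option (Fin n))
    (mβ := Real.measurableSpace)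
    (fun o => o.elim (⋃ i : Fin n, S.1.symm^[i] ⁻¹' B)ᶜ fun i => S.1.symm^[i] ⁻¹' B)
    (by
      rintro (_ | i)
      · exact (MeasurableSet.iUnion fun i : Fin n => hLm i).compl
      · exact hLm i)
    (fun o => o.elim (fun _ => p) fun i x => T.1^[i] (φ (S.1.symm^[i] x)))
    (by
      rintro (_ | i)
      · exact measurable_const
      · exact (T.1.measurable.iterate i).comp (hφ.comp (S.1.symm.measurable.iterate i)))
    (by
      rintro (_ | i) (_ | j) hij x ⟨hx, hx'⟩
      · exact absurd rfl hij
      · exact absurd (mem_iUnion.2 ⟨j, hx'⟩) hx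
      · exact absurd (mem_iUnion.2 ⟨i, hx⟩) hx'
      · exact absurd (congrArg some (Fin.ext (hdisj i i.2 j j.2 x hx hx'))) hij)
  have hψ1 : ∀ i < n, ∀ x, S.1.symm^[i] x ∈ B → ψ x = T.1^[i] (φ (S.1.symm^[i] x)) :=
    fun i hi x hx => hψt (some ⟨i, hi⟩) hx
  have hψ2 : ∀ x, (∀ i < n, S.1.symm^[i] x ∉ B) → ψ x = p := fun x hx => hψt none (by
    change x ∈ (⋃ i : Fin n, S.1.symm^[i] ⁻¹' B)ᶜ
    simp only [mem_compl_iff, mem_iUnion, not_exists]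
    exact fun i => hx i i.2)
  refine ⟨B, φ, ψ, p, hB, hφ, hψ, hp, fun s hs => ?_, fun i hi y hy => ?_, hψ2, fun s hsK hs => ?_⟩
  · rw [hφW s hs]
    exact measure_mono inter_subset_left
  · rw [hψ1 i hi _ (by rwa [symm_iterate_iterate]), symm_iterate_iterate]
  · have hdec : ψ ⁻¹' s = ⋃ i ∈ Finset.range n,
        S.1.symm^[i] ⁻¹' (φ ⁻¹' (T.1^[i] ⁻¹' s) ∩ B) := by
      ext x
      simp only [mem_preimage, mem_iUnion, Finset.mem_range, mem_inter_iff, exists_prop]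
      constructor
      · intro hx
        by_contra! hno
        have : ψ x = p := hψ2 x fun i hi hxB => hno i hi (by rwa [hψ1 i hi x hxB] at hx) hxB
        exact hp (hsK (this ▸ hx))
      · rintro ⟨i, hi, h1, h2⟩
        rwa [hψ1 i hi x h2]
    have hpm : ∀ i, MeasurableSet (φ ⁻¹' (T.1^[i] ⁻¹' s) ∩ B) := fun i =>
      (hφ ((T.1.measurable.iterate i) hs)).inter hB
    have hsum : volume (ψ ⁻¹' s) = ∑ i ∈ Finset.range n, volume (φ ⁻¹' (T.1^[i] ⁻¹' s) ∩ B) := by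
      rw [hdec, measure_biUnion_finset]
      · refine Finset.sum_congr rfl fun i _ => ?_
        exact ((measurePreserving_symm S).iterate i).measure_preimage (hpm i).nullMeasurableSet
      · intro i hi j hj hij
        refine disjoint_left.2 fun x hx hx' => hij ?_
        exact hdisj i (by simpa using hi) j (by simpa using hj) x hx.2 hx'.2
      · exact fun i _ => (S.1.symm.measurable.iterate i) (hpm i)
    have : n * volume (ψ ⁻¹' s) = n * volume s := by
      rw [hsum, Finset.mul_sum]
      -- Each floor contributes exactly `μ(s) / n`, since the preimage of `s` under `T^i` lies in
      -- `W` and has the measure of `s`.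
      have : ∀ i ∈ Finset.range n, n * volume (φ ⁻¹' (T.1^[i] ⁻¹' s) ∩ B) = volume s := by
        intro i hi
        rw [hφW _ ((T.1.measurable.iterate i) hs), inter_eq_left.2,
          (T.2.iterate i).measure_preimage hs.nullMeasurableSet]
        exact (preimage_mono hsK).trans
          (subset_biUnion_of_mem (u := fun i => T.1^[i] ⁻¹' K') hi)
      rw [Finset.sum_congr rfl this]
      simp
    exact (ENNReal.mul_right_inj hn0 hnt).1 this

/-- A conjugate of an anti-periodic transformation approximates any given transformation on finitely
many sets of finite measure. -/
theorem AntiPeriodic.exists_conjugate_approx {S : Transformation} (hS : AntiPeriodic S)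
    (T : Transformation) {ι : Type*} [Finite ι] {D : ι → Set ℝ} (hD : ∀ i, MeasurableSet (D i))
    (hDfin : ∀ i, volume (D i) ≠ ⊤) {n : ℕ} (hn : n ≠ 0) :
    ∃ R : Transformation, ∀ i, n * volume (((conjugate R S).1 ⁻¹' D i) ∆ (T.1 ⁻¹' D i)) ≤
      2 * volume (⋃ i, D i) := by
  set K := ⋃ i, D i with hK
  have hKm : MeasurableSet K := MeasurableSet.iUnion hD
  have hKfin : volume K ≠ ⊤ := by
    have := Fintype.ofFinite ι
    exact ((measure_iUnion_fintype_le _ _).trans_lt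
      (ENNReal.sum_lt_top.2 fun i _ => lt_top_iff_ne_top.2 (hDfin i))).ne
  set K' := K ∪ T.1 ⁻¹' K with hK'
  have hKm' : MeasurableSet K' := hKm.union (T.1.measurable hKm)
  have hKfin' : volume K' ≠ ⊤ := by
    refine measure_union_ne_top hKfin ?_
    rwa [T.2.measure_preimage hKm.nullMeasurableSet]
  obtain ⟨B, φ, ψ, p, hB, hφ, hψ, hp, hφv, hψ1, hψ2, hψv⟩ :=
    hS.exists_tower_copy T hKm' hKfin' hn
  let l : ℝ → (ι → Prop) := fun x i => x ∈ D i
  have hl : Measurable l := measurable_pi_lambda _ fun i => (hD i).mem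
  -- The label also records the position of `T x`, so that `R` respects membership of both `R x` and
  -- `T (R x)` in the sets `D i`. This is why `K'` contains the preimage of `K`.
  let L : ℝ → (ι → Prop) × (ι → Prop) := fun x => (l x, l (T.1 x))
  have hL : Measurable L := hl.prodMk (hl.comp T.1.measurable)
  have hLK : ∀ x, x ∉ K' → L x = (fun _ => False, fun _ => False) := by
    intro x hx
    simp only [hK', mem_union, not_or, hK, mem_preimage, mem_iUnion, not_exists] at hx
    refine Prod.ext ?_ ?_
    · funext i
      exact eq_false (hx.1 i)
    · funext i
      exact eq_false (hx.2 i)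
  have hLK' : ∀ x ∈ K', L x ≠ (fun _ => False, fun _ => False) := by
    intro x hx h
    obtain ⟨h1, h2⟩ := Prod.ext_iff.1 h
    rcases hx with hx | hx
    · obtain ⟨i, hi⟩ := mem_iUnion.1 hx
      exact (congrFun h1 i).mp hi
    · obtain ⟨i, hi⟩ := mem_iUnion.1 hx
      exact (congrFun h2 i).mp hi
  -- The all-false label marks the complement of `K'`; its two level sets have equal measure because
  -- those of `K'` do. The other level sets lie in `K'`, where `ψ` preserves measure.
  obtain ⟨R, hR⟩ := exists_transformation_of_label (f := L ∘ ψ) (g := L) (hL.comp hψ) hL (by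
    intro e
    by_cases he : e = (fun _ => False, fun _ => False)
    · have h1 : L ⁻¹' {e} = K'ᶜ := by
        ext x
        simp only [mem_preimage, mem_singleton_iff, mem_compl_iff, he]
        exact ⟨fun h hx => hLK' x hx h, hLK x⟩
      rw [preimage_comp, h1, preimage_compl, measure_compl (hψ hKm')
        (by rwa [hψv K' Subset.rfl hKm']), measure_compl hKm' hKfin', hψv K' Subset.rfl hKm']
    · rw [preimage_comp]
      refine hψv _ (fun x hx => ?_) (hL (measurableSet_singleton e))
      by_contra hxK
      exact he ((mem_singleton_iff.1 hx).symm.trans (hLK x hxK)))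
  refine ⟨R, fun i => ?_⟩
  -- The bad points: `b₁` enters the base at a point that `ψ` maps into `K`, and `b₂` is the part of
  -- the top floor that `T ∘ ψ` maps into `K`. Elsewhere either `S` moves up one floor and `ψ`
  -- intertwines it with `T`, or both `ψ (S x)` and `T (ψ x)` avoid `K`.
  set b₁ := S.1 ⁻¹' (φ ⁻¹' K ∩ B) with hb₁
  set b₂ := S.1.symm^[n - 1] ⁻¹' (φ ⁻¹' (T.1^[n] ⁻¹' K) ∩ B) with hb₂
  have hTn : MeasurableSet (T.1^[n] ⁻¹' K) := (T.1.measurable.iterate n) hKm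
  have hv₁ : n * volume b₁ ≤ volume K := by
    rw [hb₁, S.2.measure_preimage ((hφ hKm).inter hB).nullMeasurableSet]
    exact hφv K hKm
  have hv₂ : n * volume b₂ ≤ volume K := by
    rw [hb₂, ((measurePreserving_symm S).iterate _).measure_preimage
      ((hφ hTn).inter hB).nullMeasurableSet, ← (T.2.iterate n).measure_preimage
        hKm.nullMeasurableSet]
    exact hφv _ hTn
  have hdet : ∀ x, x ∉ b₁ → x ∉ b₂ → (ψ (S.1 x) ∈ D i ↔ T.1 (ψ x) ∈ D i) := by
    intro x hx₁ hx₂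
    have hstep : ∀ j, j + 1 < n → S.1.symm^[j] x ∈ B → ψ (S.1 x) = T.1 (ψ x) := by
      intro j hj hxj
      have h1 := hψ1 j (by omega) _ hxj
      have h2 := hψ1 (j + 1) hj _ hxj
      rw [Function.iterate_succ_apply', Function.iterate_succ_apply',
        iterate_symm_iterate] at h2
      rw [iterate_symm_iterate] at h1
      rw [h2, h1]
    by_cases hx : ∃ j, j + 1 < n ∧ S.1.symm^[j] x ∈ B
    · obtain ⟨j, hj, hxj⟩ := hx
      rw [hstep j hj hxj]
    push Not at hx
    have n1 : ψ (S.1 x) ∉ D i := by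
      intro h
      have hKx : ψ (S.1 x) ∈ K := mem_iUnion.2 ⟨i, h⟩
      by_cases hex : ∃ j < n, S.1.symm^[j] (S.1 x) ∈ B
      · obtain ⟨j, hj, hxj⟩ := hex
        rcases j with _ | j
        · refine hx₁ ⟨?_, hxj⟩
          have := hψ1 0 hj _ hxj
          simp only [Function.iterate_zero, id_eq] at this
          rwa [mem_preimage, ← this]
        · rw [Function.iterate_succ_apply, S.1.symm_apply_apply] at hxj
          exact hx j hj hxj
      · push Not at hex
        rw [hψ2 _ hex] at hKx
        exact hp (Or.inl hKx)
    have n2 : T.1 (ψ x) ∉ D i := by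
      intro h
      have hKx : T.1 (ψ x) ∈ K := mem_iUnion.2 ⟨i, h⟩
      by_cases hex : ∃ j < n, S.1.symm^[j] x ∈ B
      · obtain ⟨j, hj, hxj⟩ := hex
        have hjn : j = n - 1 := by
          by_contra hne
          exact hx j (by omega) hxj
        subst hjn
        refine hx₂ ⟨?_, hxj⟩
        have h1 := hψ1 (n - 1) (by omega) _ hxj
        rw [iterate_symm_iterate] at h1
        rw [h1, ← Function.iterate_succ_apply' (f := T.1), Nat.succ_eq_add_one,
          Nat.sub_add_cancel (Nat.one_le_iff_ne_zero.2 hn)] at hKx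
        exact hKx
      · push Not at hex
        rw [hψ2 _ hex] at hKx
        exact hp (Or.inr hKx)
    exact iff_of_false n1 n2
  have hae : ∀ᵐ x, x ∉ b₁ ∪ b₂ →
      x ∉ R.1 ⁻¹' (((conjugate R S).1 ⁻¹' D i) ∆ (T.1 ⁻¹' D i)) := by
    have hRS := S.2.quasiMeasurePreserving.ae hR
    filter_upwards [hR, hRS] with x h1 h2 hxb
    rw [mem_union, not_or] at hxb
    have e1 : (R.1 (S.1 x) ∈ D i) = (ψ (S.1 x) ∈ D i) := congrFun (Prod.ext_iff.1 h2).1 i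
    have e2 : (T.1 (R.1 x) ∈ D i) = (T.1 (ψ x) ∈ D i) := congrFun (Prod.ext_iff.1 h1).2 i
    have e3 : (conjugate R S).1 (R.1 x) = R.1 (S.1 x) := by
      simp [conjugate]
    rw [mem_preimage, mem_symmDiff, mem_preimage, mem_preimage, e3, e1, e2]
    have := hdet x hxb.1 hxb.2
    tauto
  have hle : volume (((conjugate R S).1 ⁻¹' D i) ∆ (T.1 ⁻¹' D i)) ≤ volume (b₁ ∪ b₂) := by
    rw [← R.2.measure_preimage (((conjugate R S).1.measurable (hD i)).symmDiff
      (T.1.measurable (hD i))).nullMeasurableSet]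
    refine measure_mono_ae ?_
    filter_upwards [hae] with x hx h
    by_contra hb
    exact hx hb h
  calc _ ≤ n * (volume b₁ + volume b₂) := by
        gcongr
        exact hle.trans (measure_union_le _ _)
    _ ≤ 2 * volume K := by
        rw [mul_add, two_mul]
        gcongr

/-- The class of `T` in `M(μ)`. -/
def toM (T : Transformation) : M := Quotient.mk _ T

theorem exists_toM (x : M) : ∃ T, toM T = x := Quotient.exists_rep x

theorem dist_toM (T S : Transformation) : dist (toM T) (toM S) = weakDist T S := rfl

theorem weakDist_le_of_finite (T S : Transformation) (N : ℕ) {δ : ℝ}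
    (h : ∀ i < N, weakTerm T S i ≤ δ) : weakDist T S ≤ N * δ + 2 * (1 / 2) ^ N := by
  unfold weakDist
  rw [← (summable_weakTerm T S).sum_add_tsum_nat_add N]
  refine add_le_add ?_ ?_
  · refine (Finset.sum_le_sum fun i hi => h i (Finset.mem_range.1 hi)).trans (le_of_eq ?_)
    simp
  · have hg : Summable fun i : ℕ => (1 / 2 : ℝ) ^ (i + N) :=
      (summable_nat_add_iff N).2 (summable_geometric_of_lt_one (by norm_num) (by norm_num))
    refine (((summable_nat_add_iff N).2 (summable_weakTerm T S)).tsum_le_tsum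
      (fun i => weakTerm_le T S (i + N)) hg).trans (le_of_eq ?_)
    simp_rw [pow_add]
    rw [tsum_mul_right, tsum_geometric_two]

theorem volume_real_dyadicEnum_pos (i : ℕ) : 0 < volume.real (dyadicEnum i) := by
  have hi : dyadicEnum i ∈ dyadicSets := range_dyadicEnum ▸ mem_range_self i
  obtain ⟨⟨F, hF⟩, x, hx⟩ := hi
  rw [hF] at hx
  simp only [mem_iUnion] at hx
  obtain ⟨q, hq, -⟩ := hx
  refine ENNReal.toReal_pos (fun h0 => ?_) (isDyadicSet_dyadicEnum i).volume_ne_top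
  have h3 : volume (dyadicInterval q.1 q.2) = 0 := measure_mono_null (by
    rw [hF]
    exact subset_biUnion_of_mem (u := fun p : ℤ × ℕ => dyadicInterval p.1 p.2) hq) h0
  have h4 := nonempty_Ico.1 (dyadicInterval_nonempty q.1 q.2)
  simp only [dyadicInterval, Real.volume_Ico, ENNReal.ofReal_eq_zero] at h3
  linarith

theorem AntiPeriodic.dense_conjugates {S : Transformation} (hS : AntiPeriodic S) :
    Dense {S' : M | ∃ R, S' = toM (conjugate R S)} := by
  rw [Metric.dense_iff]
  intro x ε hε
  obtain ⟨T, rfl⟩ := exists_toM x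
  obtain ⟨N, hN⟩ := exists_pow_lt_of_lt_one (show 0 < ε / 4 by positivity)
    (show (1 / 2 : ℝ) < 1 by norm_num)
  have hKfin : volume (⋃ i : Fin N, dyadicEnum i) ≠ ⊤ :=
    ((measure_iUnion_fintype_le volume fun i : Fin N => dyadicEnum i).trans_lt
      (ENNReal.sum_lt_top.2 fun i _ => lt_top_iff_ne_top.2 (isDyadicSet_dyadicEnum i).volume_ne_top)).ne
  obtain ⟨δ, hδ, hNδ⟩ : ∃ δ > 0, N * δ < ε / 2 := by
    refine ⟨ε / (2 * (N + 1)), by positivity, ?_⟩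
    rw [← mul_div_assoc, div_lt_div_iff₀ (by positivity) (by positivity)]
    nlinarith
  obtain ⟨c, hc, hcD⟩ : ∃ c > 0, ∀ i < N, c ≤ volume.real (dyadicEnum i) := by
    clear hN hKfin hNδ
    induction N with
    | zero => exact ⟨1, one_pos, fun i hi => absurd hi (Nat.not_lt_zero i)⟩
    | succ N ih =>
      obtain ⟨c, hc, h⟩ := ih
      refine ⟨min c (volume.real (dyadicEnum N)), lt_min hc (volume_real_dyadicEnum_pos N), ?_⟩
      intro i hi
      rcases Nat.lt_succ_iff_lt_or_eq.1 hi with hi | rfl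
      · exact (min_le_left _ _).trans (h i hi)
      · exact min_le_right _ _
  set k := (volume (⋃ i : Fin N, dyadicEnum i)).toReal with hk
  -- The height makes the error `2 k / n` smaller than `δ c`, where `c` bounds the first `N`
  -- denominators of the metric from below.
  obtain ⟨n, hn⟩ := exists_nat_gt (2 * k / (δ * c))
  have hk0 : 0 ≤ k := ENNReal.toReal_nonneg
  have hnpos : (0 : ℝ) < n := lt_of_le_of_lt (by positivity) hn
  have hn0 : n ≠ 0 := by
    rintro rfl
    simp at hnpos
  obtain ⟨R, hR⟩ := hS.exists_conjugate_approx T (D := fun i : Fin N => dyadicEnum i)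
    (fun i => (isDyadicSet_dyadicEnum i).measurableSet)
    (fun i => (isDyadicSet_dyadicEnum i).volume_ne_top) hn0
  refine ⟨toM (conjugate R S), ?_, R, rfl⟩
  rw [Metric.mem_ball, dist_toM]
  refine (weakDist_le_of_finite _ _ N (δ := δ) fun i hi => ?_).trans_lt (by linarith)
  unfold weakTerm
  have h1 := ENNReal.toReal_mono (ENNReal.mul_ne_top ENNReal.ofNat_ne_top hKfin) (hR ⟨i, hi⟩)
  rw [ENNReal.toReal_mul, ENNReal.toReal_mul, ENNReal.toReal_natCast, ENNReal.toReal_ofNat,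
    ← hk] at h1
  change n * volume.real _ ≤ _ at h1
  have h2 := hcD i hi
  have h3 : (1 : ℝ) ≤ 2 ^ (i + 1) := one_le_pow₀ (by norm_num)
  rw [div_lt_iff₀ (by positivity)] at hn
  rw [div_le_iff₀ (mul_pos (by positivity) (volume_real_dyadicEnum_pos i))]
  have h4 : δ * c ≤ δ * (2 ^ (i + 1) * volume.real (dyadicEnum i)) := by
    gcongr
    nlinarith
  refine le_trans ?_ h4
  by_contra! h5
  have := mul_lt_mul_of_pos_left h5 hnpos
  linarith

/-! ### Ergodicity as approximability by coboundaries -/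

section Coboundary

variable {X : Type*} [MeasurableSpace X] {μ : Measure X}

/-- The group of integral combinations of indicators of sets of finite measure. -/
def indicatorGroup (μ : Measure X) : AddSubgroup (X → ℝ) :=
  AddSubgroup.closure {f | ∃ C, MeasurableSet C ∧ μ C ≠ ⊤ ∧ f = C.indicator 1}

theorem indicator_mem_indicatorGroup {C : Set X} (hC : MeasurableSet C) (hC' : μ C ≠ ⊤) :
    C.indicator 1 ∈ indicatorGroup μ :=
  AddSubgroup.subset_closure ⟨C, hC, hC', rfl⟩

theorem integrable_indicator_one {C : Set X} (hC : MeasurableSet C) (hC' : μ C ≠ ⊤) :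
    Integrable (C.indicator (1 : X → ℝ)) μ :=
  (integrableOn_const hC').integrable_indicator hC

theorem measurable_of_mem_indicatorGroup {g : X → ℝ} (hg : g ∈ indicatorGroup μ) :
    Measurable g := by
  induction hg using AddSubgroup.closure_induction with
  | mem f hf =>
    obtain ⟨C, hC, -, rfl⟩ := hf
    exact measurable_one.indicator hC
  | zero => exact measurable_zero
  | add f h _ _ hf hh => exact hf.add hh
  | neg f _ hf => exact hf.neg

theorem integrable_of_mem_indicatorGroup {g : X → ℝ} (hg : g ∈ indicatorGroup μ) :
    Integrable g μ := by
  induction hg using AddSubgroup.closure_induction with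
  | mem f hf =>
    obtain ⟨C, hC, hC', rfl⟩ := hf
    exact integrable_indicator_one hC hC'
  | zero => exact integrable_zero _ _ _
  | add f h _ _ hf hh => exact hf.add hh
  | neg f _ hf => exact hf.neg

theorem comp_mem_indicatorGroup {U : X → X} (hU : MeasurePreserving U μ μ) {g : X → ℝ}
    (hg : g ∈ indicatorGroup μ) : g ∘ U ∈ indicatorGroup μ := by
  induction hg using AddSubgroup.closure_induction with
  | mem f hf =>
    obtain ⟨C, hC, hC', rfl⟩ := hf
    refine AddSubgroup.subset_closure ⟨U ⁻¹' C, hU.measurable hC, ?_, rfl⟩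
    rwa [hU.measure_preimage hC.nullMeasurableSet]
  | zero => exact zero_mem _
  | add f h _ _ hf hh => exact add_mem hf hh
  | neg f _ hf => exact neg_mem hf

/-- The difference of the indicators of `A` and `B` is, up to the difference of their measures and
an error `ε`, a coboundary for `U`. -/
def NearCoboundary (μ : Measure X) (U : X → X) (A B : Set X) (ε : ℝ) : Prop :=
  ∃ g ∈ indicatorGroup μ, ∫⁻ x, ‖A.indicator (1 : X → ℝ) x - B.indicator (1 : X → ℝ) x -
    (g x - g (U x))‖ₑ ∂μ < ENNReal.ofReal (|μ.real A - μ.real B| + ε)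

theorem setIntegral_indicator_one {I A : Set X} (hA : MeasurableSet A) :
    ∫ x in I, A.indicator (1 : X → ℝ) x ∂μ = μ.real (I ∩ A) := by
  rw [setIntegral_indicator hA]
  simp

/-- Integrate over the invariant set `I`: the coboundary contributes zero, and the rest is bounded
by the `L¹` error. -/
theorem abs_measureReal_inter_sub_lt {U : X ≃ᵐ X} (hU : MeasurePreserving U μ μ)
    {A B I : Set X} (hA : MeasurableSet A) (hB : MeasurableSet B) (hA' : μ A ≠ ⊤) (hB' : μ B ≠ ⊤)
    (hI : U ⁻¹' I = I) {ε : ℝ} (h : NearCoboundary μ U A B ε) :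
    |μ.real (I ∩ A) - μ.real (I ∩ B)| < |μ.real A - μ.real B| + ε := by
  obtain ⟨g, hg, hlt⟩ := h
  have hgi := integrable_of_mem_indicatorGroup hg
  have hgU : Integrable (fun x => g (U x)) μ :=
    integrable_of_mem_indicatorGroup (comp_mem_indicatorGroup hU hg)
  have hAi := integrable_indicator_one hA hA'
  have hBi := integrable_indicator_one hB hB'
  have hinv : ∫ x in I, g (U x) ∂μ = ∫ x in I, g x ∂μ := by
    conv_lhs => rw [← hI]
    exact hU.setIntegral_preimage_emb U.measurableEmbedding g I
  have hint : ∫ x in I, (A.indicator (1 : X → ℝ) x - B.indicator (1 : X → ℝ) x -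
      (g x - g (U x))) ∂μ = μ.real (I ∩ A) - μ.real (I ∩ B) := by
    rw [integral_sub (f := fun x => A.indicator (1 : X → ℝ) x - B.indicator (1 : X → ℝ) x)
        (g := fun x => g x - g (U x)) (hAi.sub hBi).integrableOn (hgi.sub hgU).integrableOn,
      integral_sub hAi.integrableOn hBi.integrableOn,
      integral_sub hgi.integrableOn hgU.integrableOn, hinv, setIntegral_indicator_one hA,
      setIntegral_indicator_one hB]
    ring
  have h1 : ENNReal.ofReal |μ.real (I ∩ A) - μ.real (I ∩ B)| <
      ENNReal.ofReal (|μ.real A - μ.real B| + ε) := by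
    rw [← Real.norm_eq_abs, ofReal_norm, ← hint]
    exact (enorm_integral_le_lintegral_enorm _).trans_lt
      ((setLIntegral_le_lintegral _ _).trans_lt hlt)
  exact (ENNReal.ofReal_lt_ofReal_iff_of_nonneg (abs_nonneg _)).1 h1

theorem abs_measureReal_sub_le_symmDiff {A t : Set X} (hA' : μ A ≠ ⊤) (ht' : μ t ≠ ⊤) (I : Set X) :
    |μ.real (I ∩ A) - μ.real (I ∩ t)| ≤ μ.real (A ∆ t) := by
  have hfin : μ (A ∆ t) ≠ ⊤ :=
    measure_ne_top_of_subset symmDiff_subset_union (measure_union_ne_top hA' ht')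
  have key : ∀ {C D : Set X}, μ D ≠ ⊤ → μ (C ∆ D) ≠ ⊤ →
      μ.real (I ∩ C) ≤ μ.real (I ∩ D) + μ.real (C ∆ D) := by
    intro C D hD hCD
    refine (measureReal_mono (s₂ := (I ∩ D) ∪ (C ∆ D)) (fun x hx => ?_) ?_).trans
      (measureReal_union_le _ _)
    · by_cases hxD : x ∈ D
      · exact Or.inl ⟨hx.1, hxD⟩
      · exact Or.inr (Or.inl ⟨hx.2, hxD⟩)
    · exact measure_union_ne_top (measure_ne_top_of_subset inter_subset_right hD) hCD
  have h1 := key ht' hfin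
  have h2 := key (C := t) hA' (by rwa [symmDiff_comm])
  rw [symmDiff_comm] at h2
  rw [abs_le]
  constructor <;> linarith

/-- For a nontrivial invariant `I`, choose `A ⊆ I` and `B ⊆ Iᶜ` of finite positive measure.
Integration over `I` and over `Iᶜ` bounds both `μ A` and `μ B` by `|μ A - μ B|`, which is
impossible. -/
theorem ergodic_of_nearCoboundary [SigmaFinite μ] {U : X ≃ᵐ X} (hU : MeasurePreserving U μ μ)
    {𝒜 : Set (Set X)} (h𝒜 : μ.MeasureDense 𝒜)
    (h : ∀ A ∈ 𝒜, ∀ B ∈ 𝒜, μ A ≠ ⊤ → μ B ≠ ⊤ → ∀ n : ℕ, NearCoboundary μ U A B (1 / (n + 1))) :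
    Ergodic U μ := by
  refine ⟨hU, ⟨fun I hI hUI => ?_⟩⟩
  have hgen : ∀ A B, MeasurableSet A → MeasurableSet B → μ A ≠ ⊤ → μ B ≠ ⊤ →
      ∀ J, U ⁻¹' J = J → |μ.real (J ∩ A) - μ.real (J ∩ B)| ≤ |μ.real A - μ.real B| := by
    intro A B hA hB hA' hB' J hJ
    refine le_of_forall_pos_lt_add fun ε hε => ?_
    -- Five errors: replacing `A` and `B` inside `J`, replacing them in the total measures, and `1 /
    -- (n + 1)`.
    obtain ⟨n, hn⟩ := exists_nat_one_div_lt (show 0 < ε / 5 by positivity)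
    have app : ∀ C, MeasurableSet C → μ C ≠ ⊤ → ∃ t ∈ 𝒜, MeasurableSet t ∧ μ t ≠ ⊤ ∧
        μ.real (C ∆ t) < ε / 5 := by
      intro C hC hC'
      obtain ⟨t, ht, hCt⟩ := h𝒜.approx C hC hC' (ε / 5) (by positivity)
      refine ⟨t, ht, h𝒜.measurable t ht, ?_, ?_⟩
      · refine ne_top_of_le_ne_top (measure_union_ne_top hC' (hCt.trans ENNReal.ofReal_lt_top).ne)
          (measure_mono (t := C ∪ C ∆ t) fun x hx => ?_)
        by_cases hxC : x ∈ C
        · exact Or.inl hxC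
        · exact Or.inr (Or.inr ⟨hx, hxC⟩)
      · exact (ENNReal.lt_ofReal_iff_toReal_lt (hCt.trans ENNReal.ofReal_lt_top).ne).1 hCt
    obtain ⟨s, hs, hsm, hs', hAs⟩ := app A hA hA'
    obtain ⟨t, ht, htm, ht', hBt⟩ := app B hB hB'
    have h0 := abs_measureReal_inter_sub_lt hU hsm htm hs' ht' hJ
      (h s hs t ht hs' ht' n)
    have h1 := abs_le.1 (abs_measureReal_sub_le_symmDiff hA' hs' J)
    have h2 := abs_le.1 (abs_measureReal_sub_le_symmDiff hB' ht' J)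
    have h3 := abs_le.1 (abs_measureReal_sub_le_symmDiff hA' hs' univ)
    have h4 := abs_le.1 (abs_measureReal_sub_le_symmDiff hB' ht' univ)
    simp only [univ_inter] at h3 h4
    have h5 : |μ.real s - μ.real t| ≤ |μ.real A - μ.real B| + 2 * (ε / 5) := by
      have := abs_le.1 (le_refl |μ.real A - μ.real B|)
      rw [abs_le]
      constructor <;> linarith
    have h6 := abs_lt.1 (h0.trans_le (add_le_add h5 hn.le))
    rw [abs_lt]
    constructor <;> linarith
  rw [Filter.eventuallyConst_set']
  by_contra! hne
  have hI0 : 0 < μ I := pos_iff_ne_zero.2 fun h0 => hne.1 (ae_eq_empty.2 h0)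
  have hI1 : 0 < μ Iᶜ := pos_iff_ne_zero.2 fun h0 => hne.2 (ae_eq_univ.2 h0)
  obtain ⟨A, hA, hAI, hA0, hA'⟩ := Measure.exists_subset_measure_lt_top hI hI0
  obtain ⟨B, hB, hBI, hB0, hB'⟩ := Measure.exists_subset_measure_lt_top hI.compl hI1
  have a0 : 0 < μ.real A := ENNReal.toReal_pos hA0.ne' hA'.ne
  have b0 : 0 < μ.real B := ENNReal.toReal_pos hB0.ne' hB'.ne
  have e1 : I ∩ A = A := inter_eq_right.2 hAI
  have e2 : I ∩ B = ∅ := eq_empty_of_forall_notMem fun x hx => hBI hx.2 hx.1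
  have e3 : Iᶜ ∩ B = B := inter_eq_right.2 hBI
  have e4 : Iᶜ ∩ A = ∅ := eq_empty_of_forall_notMem fun x hx => hx.1 (hAI hx.2)
  have k1 := hgen A B hA hB hA'.ne hB'.ne I hUI
  have k2 := hgen A B hA hB hA'.ne hB'.ne Iᶜ (by rw [preimage_compl, hUI])
  rw [e1, e2, measureReal_empty, sub_zero, abs_of_pos a0] at k1
  rw [e3, e4, measureReal_empty, zero_sub, abs_neg, abs_of_pos b0] at k2
  rcases abs_cases (μ.real A - μ.real B) with h | h <;> linarith

/-- The integral powers of an invertible transformation. -/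
def power (U : X ≃ᵐ X) (n : ℤ) : X → X := ((U.toEquiv : Equiv.Perm X) ^ n : Equiv.Perm X)

theorem power_zero (U : X ≃ᵐ X) : power U 0 = id := by
  simp [power]

theorem power_add_one_apply (U : X ≃ᵐ X) (n : ℤ) (x : X) :
    power U (n + 1) x = power U n (U x) := by
  simp only [power, zpow_add_one, Equiv.Perm.mul_apply]
  rfl

theorem power_power_neg (U : X ≃ᵐ X) (n : ℤ) (x : X) : power U n (power U (-n) x) = x := by
  simp [power]

theorem measurePreserving_power {U : X ≃ᵐ X} (hU : MeasurePreserving U μ μ) (n : ℤ) :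
    MeasurePreserving (power U n) μ μ := by
  rcases n with n | n
  · have : power U (Int.ofNat n) = U^[n] := by
      rw [power, Int.ofNat_eq_natCast, zpow_natCast, Equiv.Perm.coe_pow]
      rfl
    rw [this]
    exact hU.iterate n
  · have : power U (Int.negSucc n) = U.symm^[n + 1] := by
      rw [power, zpow_negSucc, ← inv_pow, Equiv.Perm.coe_pow]
      rfl
    rw [this]
    exact (hU.symm U).iterate (n + 1)

/-- `h` is the coboundary of an element of `indicatorGroup μ`. -/
def IsIndicatorCoboundary (μ : Measure X) (U : X → X) (h : X → ℝ) : Prop :=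
  ∃ g ∈ indicatorGroup μ, ∀ x, h x = g x - g (U x)

theorem IsIndicatorCoboundary.add {U : X → X} {h k : X → ℝ} (hh : IsIndicatorCoboundary μ U h)
    (hk : IsIndicatorCoboundary μ U k) : IsIndicatorCoboundary μ U (h + k) := by
  obtain ⟨g, hg, e⟩ := hh
  obtain ⟨g', hg', e'⟩ := hk
  exact ⟨g + g', add_mem hg hg', fun x => by simp only [Pi.add_apply, e, e']; ring⟩

theorem IsIndicatorCoboundary.neg {U : X → X} {h : X → ℝ} (hh : IsIndicatorCoboundary μ U h) :
    IsIndicatorCoboundary μ U (-h) := by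
  obtain ⟨g, hg, e⟩ := hh
  exact ⟨-g, neg_mem hg, fun x => by simp only [Pi.neg_apply, e]; ring⟩

/-- The difference telescopes along the orbit, in either direction of time. -/
theorem isIndicatorCoboundary_sub_comp_power {U : X ≃ᵐ X} (hU : MeasurePreserving U μ μ)
    {f : X → ℝ} (hf : f ∈ indicatorGroup μ) (n : ℤ) :
    IsIndicatorCoboundary μ U (f - f ∘ power U n) := by
  have hc : ∀ n, f ∘ power U n ∈ indicatorGroup μ := fun n =>
    comp_mem_indicatorGroup (measurePreserving_power hU n) hf
  induction n using Int.induction_on with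
  | zero => exact ⟨0, zero_mem _, fun x => by simp [power_zero]⟩
  | succ n ih =>
    have h1 : IsIndicatorCoboundary μ U (f ∘ power U n - f ∘ power U (n + 1)) :=
      ⟨_, hc n, fun x => by simp [power_add_one_apply]⟩
    simpa using ih.add h1
  | pred n ih =>
    have h1 : IsIndicatorCoboundary μ U (f ∘ power U (-n - 1) - f ∘ power U (-n)) :=
      ⟨_, hc (-n - 1), fun x => by simp [← power_add_one_apply]⟩
    simpa using ih.add h1.neg

/-- What remains of `A` and `B` when images of parts of `A` under the powers of `U` are matched
greedily with parts of `B`. -/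
def remainders (U : X ≃ᵐ X) (m : ℕ → ℤ) (A B : Set X) : ℕ → Set X × Set X
  | 0 => (A, B)
  | j + 1 => ((remainders U m A B j).1 \ power U (m j) ⁻¹' (remainders U m A B j).2,
      (remainders U m A B j).2 \ power U (-m j) ⁻¹' (remainders U m A B j).1)

variable {U : X ≃ᵐ X} {m : ℕ → ℤ} {A B : Set X}

theorem measurableSet_remainders (hU : MeasurePreserving U μ μ) (hA : MeasurableSet A)
    (hB : MeasurableSet B) (j : ℕ) : MeasurableSet (remainders U m A B j).1 ∧
      MeasurableSet (remainders U m A B j).2 := by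
  induction j with
  | zero => exact ⟨hA, hB⟩
  | succ j ih =>
    exact ⟨ih.1.diff ((measurePreserving_power hU _).measurable ih.2),
      ih.2.diff ((measurePreserving_power hU _).measurable ih.1)⟩

theorem antitone_remainders_fst : Antitone fun j => (remainders U m A B j).1 :=
  antitone_nat_of_succ_le fun _ => sdiff_subset

theorem antitone_remainders_snd : Antitone fun j => (remainders U m A B j).2 :=
  antitone_nat_of_succ_le fun _ => sdiff_subset

theorem preimage_power_neg_inter (n : ℤ) (P Q : Set X) :
    power U (-n) ⁻¹' (P ∩ power U n ⁻¹' Q) = Q ∩ power U (-n) ⁻¹' P := by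
  ext x
  simp only [mem_preimage, mem_inter_iff, power_power_neg]
  exact and_comm

theorem indicator_sdiff_add_inter {Y : Type*} (P Q : Set Y) :
    P.indicator (1 : Y → ℝ) = (P \ Q).indicator 1 + (P ∩ Q).indicator 1 := by
  classical
  funext x
  simp only [indicator_apply, Pi.add_apply, mem_sdiff, mem_inter_iff]
  by_cases h1 : x ∈ P <;> by_cases h2 : x ∈ Q <;> simp [h1, h2]

/-- Each step removes a set from the first remainder and its image under a power of `U` from the
second. The difference of the two indicators is a coboundary by telescoping. -/
theorem isIndicatorCoboundary_remainders (hU : MeasurePreserving U μ μ) (hA : MeasurableSet A)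
    (hB : MeasurableSet B) (hA' : μ A ≠ ⊤) (j : ℕ) :
    IsIndicatorCoboundary μ U (A.indicator 1 - B.indicator 1 -
      ((remainders U m A B j).1.indicator 1 - (remainders U m A B j).2.indicator 1)) := by
  induction j with
  | zero => exact ⟨0, zero_mem _, fun x => by simp [remainders]⟩
  | succ j ih =>
    have hm := measurableSet_remainders (m := m) hU hA hB j
    have hsub : (remainders U m A B j).1 ⊆ A := antitone_remainders_fst (Nat.zero_le j)
    set P := (remainders U m A B j).1
    set Q := (remainders U m A B j).2
    have hC : (P ∩ power U (m j) ⁻¹' Q).indicator 1 ∈ indicatorGroup μ :=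
      indicator_mem_indicatorGroup
        (hm.1.inter ((measurePreserving_power hU _).measurable hm.2))
        (measure_ne_top_of_subset (inter_subset_left.trans hsub) hA')
    have h1 := isIndicatorCoboundary_sub_comp_power hU hC (-m j)
    have h2 : (P ∩ power U (m j) ⁻¹' Q).indicator (1 : X → ℝ) ∘ power U (-m j) =
        (Q ∩ power U (-m j) ⁻¹' P).indicator 1 := by
      rw [← preimage_power_neg_inter]
      rfl
    rw [h2] at h1
    have h3 := ih.add h1
    change IsIndicatorCoboundary μ U (A.indicator 1 - B.indicator 1 -
      ((P \ power U (m j) ⁻¹' Q).indicator 1 - (Q \ power U (-m j) ⁻¹' P).indicator 1))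
    convert h3 using 1
    rw [indicator_sdiff_add_inter P (power U (m j) ⁻¹' Q),
      indicator_sdiff_add_inter Q (power U (-m j) ⁻¹' P)]
    ring

theorem measureReal_remainders_sub (hU : MeasurePreserving U μ μ) (hA : MeasurableSet A)
    (hB : MeasurableSet B) (hA' : μ A ≠ ⊤) (hB' : μ B ≠ ⊤) (j : ℕ) :
    μ.real (remainders U m A B j).1 - μ.real (remainders U m A B j).2 =
      μ.real A - μ.real B := by
  induction j with
  | zero => rfl
  | succ j ih =>
    have hm := measurableSet_remainders (m := m) hU hA hB j
    have hsub : (remainders U m A B j).1 ⊆ A := antitone_remainders_fst (Nat.zero_le j)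
    have hsub' : (remainders U m A B j).2 ⊆ B := antitone_remainders_snd (Nat.zero_le j)
    rw [← ih]
    change μ.real ((remainders U m A B j).1 \ power U (m j) ⁻¹' (remainders U m A B j).2) -
      μ.real ((remainders U m A B j).2 \ power U (-m j) ⁻¹' (remainders U m A B j).1) = _
    set P := (remainders U m A B j).1
    set Q := (remainders U m A B j).2
    have hQm := (measurePreserving_power hU (m j)).measurable hm.2
    have h1 := measureReal_inter_add_sdiff (μ := μ) (s := P) hQm
      (measure_ne_top_of_subset hsub hA')
    have h2 := measureReal_inter_add_sdiff (μ := μ) (s := Q)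
      ((measurePreserving_power hU (-m j)).measurable hm.1)
      (measure_ne_top_of_subset hsub' hB')
    have h3 : μ.real (Q ∩ power U (-m j) ⁻¹' P) = μ.real (P ∩ power U (m j) ⁻¹' Q) := by
      rw [← preimage_power_neg_inter, measureReal_def, measureReal_def,
        (measurePreserving_power hU (-m j)).measure_preimage (hm.1.inter hQm).nullMeasurableSet]
    linarith

/-- Every power of `U` is tried at some stage, so no orbit of a point left in `A` meets what is left
of `B`. The saturation of the latter is invariant, hence null or conull. -/
theorem measure_iInter_remainders (hU : Ergodic U μ) (hm : Function.Surjective m)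
    (hA : MeasurableSet A) (hB : MeasurableSet B) :
    μ (⋂ j, (remainders U m A B j).1) = 0 ∨ μ (⋂ j, (remainders U m A B j).2) = 0 := by
  set A' := ⋂ j, (remainders U m A B j).1 with hA'
  set B' := ⋂ j, (remainders U m A B j).2 with hB'
  have hrm := fun j => measurableSet_remainders (m := m) hU.toMeasurePreserving hA hB j
  have hB'm : MeasurableSet B' := MeasurableSet.iInter fun j => (hrm j).2
  have hdis : ∀ x ∈ A', ∀ n, power U n x ∉ B' := by
    intro x hx n hn
    obtain ⟨j, rfl⟩ := hm n
    exact (mem_iInter.1 hx (j + 1)).2 (mem_iInter.1 hn j)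
  set V := ⋃ n : ℤ, power U n ⁻¹' B' with hV
  have hVm : MeasurableSet V := MeasurableSet.iUnion fun n =>
    (measurePreserving_power hU.toMeasurePreserving n).measurable hB'm
  have hVU : U ⁻¹' V = V := by
    ext x
    simp only [hV, mem_preimage, mem_iUnion, ← power_add_one_apply]
    exact ⟨fun ⟨n, hn⟩ => ⟨n + 1, hn⟩, fun ⟨n, hn⟩ => ⟨n - 1, by simpa using hn⟩⟩
  rcases Filter.eventuallyConst_set'.1 (hU.aeconst_set hVm hVU) with h | h
  · right
    refine measure_mono_null (fun x hx => ?_) (ae_eq_empty.1 h)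
    exact mem_iUnion.2 ⟨0, by rw [power_zero]; exact hx⟩
  · left
    refine measure_mono_null (t := Vᶜ) (fun x hx hxV => ?_) (ae_eq_univ.1 h)
    obtain ⟨n, hn⟩ := mem_iUnion.1 hxV
    exact hdis x hx n hn

theorem lintegral_enorm_indicator_sub_le {P Q : Set X} (hP : MeasurableSet P)
    (hQ : MeasurableSet Q) :
    ∫⁻ x, ‖P.indicator (1 : X → ℝ) x - Q.indicator (1 : X → ℝ) x‖ₑ ∂μ ≤ μ P + μ Q := by
  calc _ ≤ ∫⁻ x, (P.indicator (1 : X → ENNReal) x + Q.indicator (1 : X → ENNReal) x) ∂μ := by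
        refine lintegral_mono fun x => ?_
        refine (enorm_sub_le).trans (add_le_add ?_ ?_)
        · by_cases h : x ∈ P <;> simp [h]
        · by_cases h : x ∈ Q <;> simp [h]
    _ = μ P + μ Q := by
        rw [lintegral_add_left (measurable_one.indicator hP), lintegral_indicator_one hP,
          lintegral_indicator_one hQ]

/-- One remainder shrinks to a null set while the difference of the two measures stays constant, so
their sum approaches `|μ A - μ B|`; this sum bounds the `L¹` error. -/
theorem nearCoboundary_of_ergodic (hU : Ergodic U μ) (hA : MeasurableSet A)
    (hB : MeasurableSet B) (hA' : μ A ≠ ⊤) (hB' : μ B ≠ ⊤) {ε : ℝ} (hε : 0 < ε) :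
    NearCoboundary μ U A B ε := by
  let m : ℕ → ℤ := fun j => Denumerable.ofNat ℤ j
  have hm : Function.Surjective m := fun n => ⟨Encodable.encode n, Denumerable.ofNat_encode n⟩
  have hrm := fun j => measurableSet_remainders (m := m) hU.toMeasurePreserving hA hB j
  have hfin : ∀ j, μ (remainders U m A B j).1 ≠ ⊤ := fun j =>
    measure_ne_top_of_subset (antitone_remainders_fst (Nat.zero_le j)) hA'
  have hfin' : ∀ j, μ (remainders U m A B j).2 ≠ ⊤ := fun j =>
    measure_ne_top_of_subset (antitone_remainders_snd (Nat.zero_le j)) hB'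
  have hsub := fun j =>
    measureReal_remainders_sub (m := m) hU.toMeasurePreserving hA hB hA' hB' j
  have hsmall : ∃ j, μ.real (remainders U m A B j).1 + μ.real (remainders U m A B j).2 <
      |μ.real A - μ.real B| + ε := by
    have key : ∀ s : ℕ → Set X, Antitone s → (∀ j, MeasurableSet (s j)) → (∀ j, μ (s j) ≠ ⊤) →
        μ (⋂ j, s j) = 0 → ∃ j, μ.real (s j) < ε / 2 := by
      intro s hs hsm hsf h0
      have ht := tendsto_measure_iInter_atTop (μ := μ)
        (fun j => (hsm j).nullMeasurableSet) hs ⟨0, hsf 0⟩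
      rw [h0] at ht
      have hev : ∀ᶠ j in Filter.atTop, μ (s j) < ENNReal.ofReal (ε / 2) :=
        ht.eventually (gt_mem_nhds (ENNReal.ofReal_pos.2 (half_pos hε)))
      obtain ⟨j, hj⟩ := hev.exists
      exact ⟨j, (ENNReal.lt_ofReal_iff_toReal_lt (hsf j)).1 hj⟩
    have habs := abs_le.1 (le_refl |μ.real A - μ.real B|)
    rcases measure_iInter_remainders hU hm hA hB with h | h
    · obtain ⟨j, hj⟩ := key _ antitone_remainders_fst (fun j => (hrm j).1) hfin h
      exact ⟨j, by linarith [hsub j]⟩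
    · obtain ⟨j, hj⟩ := key _ antitone_remainders_snd (fun j => (hrm j).2) hfin' h
      exact ⟨j, by linarith [hsub j]⟩
  obtain ⟨j, hj⟩ := hsmall
  obtain ⟨g, hg, hgeq⟩ :=
    isIndicatorCoboundary_remainders (m := m) hU.toMeasurePreserving hA hB hA' j
  refine ⟨g, hg, ?_⟩
  have heq : ∀ x, A.indicator (1 : X → ℝ) x - B.indicator (1 : X → ℝ) x - (g x - g (U x)) =
      (remainders U m A B j).1.indicator 1 x - (remainders U m A B j).2.indicator 1 x := by
    intro x
    have := hgeq x
    simp only [Pi.sub_apply] at this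
    linarith
  simp only [heq]
  refine (lintegral_enorm_indicator_sub_le (hrm j).1 (hrm j).2).trans_lt ?_
  rw [ENNReal.lt_ofReal_iff_toReal_lt (ENNReal.add_ne_top.2 ⟨hfin j, hfin' j⟩),
    ENNReal.toReal_add (hfin j) (hfin' j)]
  exact hj

end Coboundary

/-! ### Continuity for the weak topology -/

/-- A representative of an element of `M(μ)`. -/
def rep (S : M) : Transformation := Quotient.out S

theorem toM_rep (S : M) : toM (rep S) = S := Quotient.out_eq S

theorem tendsto_volume_symmDiff_dyadicEnum (S₀ : M) (i : ℕ) :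
    Filter.Tendsto (fun S : M => volume (((rep S).1 ⁻¹' dyadicEnum i) ∆
      ((rep S₀).1 ⁻¹' dyadicEnum i))) (nhds S₀) (nhds 0) := by
  have hc : (0 : ℝ) < 2 ^ (i + 1) * volume.real (dyadicEnum i) :=
    mul_pos (by positivity) (volume_real_dyadicEnum_pos i)
  have hle : ∀ S : M, volume (((rep S).1 ⁻¹' dyadicEnum i) ∆ ((rep S₀).1 ⁻¹' dyadicEnum i)) ≤
      ENNReal.ofReal (dist S S₀ * (2 ^ (i + 1) * volume.real (dyadicEnum i))) := by
    intro S
    rw [← ENNReal.ofReal_toReal (volume_symmDiff_ne_top (rep S) (rep S₀) i)]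
    refine ENNReal.ofReal_le_ofReal ?_
    have h1 : dist S S₀ = weakDist (rep S) (rep S₀) := by
      rw [← dist_toM, toM_rep, toM_rep]
    rw [h1, ← div_le_iff₀ hc]
    exact (summable_weakTerm (rep S) (rep S₀)).le_tsum i fun j _ => weakTerm_nonneg _ _ j
  refine tendsto_of_tendsto_of_tendsto_of_le_of_le tendsto_const_nhds ?_ (fun _ => zero_le) hle
  have h2 : Filter.Tendsto (fun S : M => dist S S₀ * (2 ^ (i + 1) * volume.real (dyadicEnum i)))
      (nhds S₀) (nhds 0) := by
    have : Continuous fun S : M => dist S S₀ * (2 ^ (i + 1) * volume.real (dyadicEnum i)) :=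
      (continuous_id.dist continuous_const).mul continuous_const
    have h3 := this.tendsto S₀
    rwa [dist_self, zero_mul] at h3
  have h4 := ENNReal.tendsto_ofReal h2
  rwa [ENNReal.ofReal_zero] at h4

/-- The measurable sets on whose preimages the weak topology gives control. -/
def continuitySets : Set (Set ℝ) :=
  {s | MeasurableSet s ∧ ∀ S₀ : M, Filter.Tendsto
    (fun S : M => volume (((rep S).1 ⁻¹' s) ∆ ((rep S₀).1 ⁻¹' s))) (nhds S₀) (nhds 0)}

theorem isSetAlgebra_continuitySets : IsSetAlgebra continuitySets where
  empty_mem := ⟨MeasurableSet.empty, fun S₀ => by simp⟩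
  compl_mem := fun s hs => ⟨hs.1.compl, fun S₀ => by
    simpa only [preimage_compl, compl_symmDiff_compl] using hs.2 S₀⟩
  union_mem := fun s t hs ht => ⟨hs.1.union ht.1, fun S₀ => by
    have h := (hs.2 S₀).add (ht.2 S₀)
    rw [add_zero] at h
    refine tendsto_of_tendsto_of_tendsto_of_le_of_le tendsto_const_nhds h (fun _ => zero_le)
      fun S => (measure_mono ?_).trans (measure_union_le _ _)
    intro x hx
    simp only [mem_symmDiff, mem_preimage, mem_union] at hx ⊢
    tauto⟩

theorem IsDyadicSet.mem_continuitySets {D : Set ℝ} (hD : IsDyadicSet D) : D ∈ continuitySets := by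
  rcases D.eq_empty_or_nonempty with rfl | hne
  · exact isSetAlgebra_continuitySets.empty_mem
  · have : D ∈ range dyadicEnum := by
      rw [range_dyadicEnum]
      exact ⟨hD, hne⟩
    obtain ⟨i, rfl⟩ := this
    exact ⟨hD.measurableSet, fun S₀ => tendsto_volume_symmDiff_dyadicEnum S₀ i⟩

theorem Iio_eq_biUnion_dyadicInterval (x : ℝ) :
    Iio x = ⋃ p ∈ {p : ℤ × ℕ | ((p.1 : ℝ) + 1) / 2 ^ p.2 ≤ x}, dyadicInterval p.1 p.2 := by
  ext y
  simp only [mem_Iio, mem_iUnion, mem_ofPred_eq, exists_prop]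
  constructor
  · intro h
    obtain ⟨j, hj⟩ := exists_pow_lt_of_lt_one (sub_pos.2 h) (show (1 / 2 : ℝ) < 1 by norm_num)
    have h2 : (0 : ℝ) < 2 ^ j := by positivity
    have h3 : (1 / 2 : ℝ) ^ j * 2 ^ j = 1 := by rw [← mul_pow]; norm_num
    have h4 := Int.floor_le (y * 2 ^ j)
    have h5 := Int.lt_floor_add_one (y * 2 ^ j)
    refine ⟨(⌊y * 2 ^ j⌋, j), ?_, ?_, ?_⟩
    · rw [div_le_iff₀ h2]
      nlinarith
    · exact (div_le_iff₀ h2).2 h4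
    · exact (lt_div_iff₀ h2).2 h5
  · rintro ⟨p, hp, hy⟩
    exact hy.2.trans_le hp

theorem measureDense_continuitySets : (volume : Measure ℝ).MeasureDense continuitySets := by
  refine Measure.MeasureDense.of_generateFrom_isSetAlgebra_sigmaFinite
    isSetAlgebra_continuitySets ⟨fun n => ⋃ p ∈ (Finset.Ico (-(n : ℤ)) n).image fun k => (k, 0),
      dyadicInterval p.1 p.2, fun n => ?_, fun n => ?_, ?_⟩ (le_antisymm ?_ ?_)
  · exact IsDyadicSet.mem_continuitySets ⟨_, rfl⟩
  · exact lt_top_iff_ne_top.2 (IsDyadicSet.volume_ne_top ⟨_, rfl⟩)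
  · refine eq_univ_of_forall fun x => ?_
    obtain ⟨n, hn⟩ := exists_nat_gt |x|
    obtain ⟨h1, h2⟩ := abs_lt.1 hn
    refine mem_iUnion.2 ⟨n, mem_biUnion (x := (⌊x⌋, 0)) ?_ ?_⟩
    · refine Finset.mem_coe.2 (Finset.mem_image.2 ⟨⌊x⌋, ?_, rfl⟩)
      rw [Finset.mem_Ico]
      refine ⟨Int.le_floor.2 (by push_cast; exact h1.le), ?_⟩
      exact Int.floor_lt.2 (by exact_mod_cast h2)
    · simp only [dyadicInterval, pow_zero, div_one]
      exact ⟨Int.floor_le x, Int.lt_floor_add_one x⟩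
  · refine (BorelSpace.measurable_eq (α := ℝ)).le.trans ?_
    rw [borel_eq_generateFrom_Iio]
    refine MeasurableSpace.generateFrom_le ?_
    rintro _ ⟨x, rfl⟩
    rw [Iio_eq_biUnion_dyadicInterval]
    exact MeasurableSet.biUnion (to_countable _) fun p _ =>
      MeasurableSpace.measurableSet_generateFrom
        (isDyadicSet_dyadicInterval p.1 p.2).mem_continuitySets
  · exact MeasurableSpace.generateFrom_le fun s hs => hs.1

/-- Approximate `C` by a set from the algebra of continuity sets. The approximation error is uniform
in `S` because every `S` preserves measure. -/
theorem tendsto_volume_symmDiff (S₀ : M) {C : Set ℝ} (hC : MeasurableSet C)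
    (hC' : volume C ≠ ⊤) :
    Filter.Tendsto (fun S : M => volume (((rep S).1 ⁻¹' C) ∆ ((rep S₀).1 ⁻¹' C)))
      (nhds S₀) (nhds 0) := by
  rw [ENNReal.tendsto_nhds_zero]
  intro ε hε
  obtain ⟨δ, hδ, hδε⟩ : ∃ δ : ℝ, 0 < δ ∧ ENNReal.ofReal (3 * δ) ≤ ε := by
    obtain ⟨r, hr, hrε⟩ := ENNReal.lt_iff_exists_nnreal_btwn.1 hε
    refine ⟨r / 3, by have : (0 : ℝ) < r := by exact_mod_cast hr
                      positivity, ?_⟩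
    rw [mul_div_cancel₀ _ (by norm_num), ENNReal.ofReal_coe_nnreal]
    exact hrε.le
  obtain ⟨D, hD, hCD⟩ := measureDense_continuitySets.approx C hC hC' δ hδ
  filter_upwards [ENNReal.tendsto_nhds_zero.1 (hD.2 S₀) (ENNReal.ofReal δ)
    (ENNReal.ofReal_pos.2 hδ)] with S hS
  have hm : MeasurableSet (C ∆ D) := hC.symmDiff hD.1
  have hsub : ((rep S).1 ⁻¹' C) ∆ ((rep S₀).1 ⁻¹' C) ⊆ ((rep S).1 ⁻¹' (C ∆ D) ∪
      ((rep S).1 ⁻¹' D) ∆ ((rep S₀).1 ⁻¹' D)) ∪ (rep S₀).1 ⁻¹' (C ∆ D) := by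
    intro x hx
    simp only [mem_symmDiff, mem_preimage, mem_union] at hx ⊢
    tauto
  calc _ ≤ volume ((rep S).1 ⁻¹' (C ∆ D)) + volume (((rep S).1 ⁻¹' D) ∆ ((rep S₀).1 ⁻¹' D)) +
        volume ((rep S₀).1 ⁻¹' (C ∆ D)) :=
        (measure_mono hsub).trans ((measure_union_le _ _).trans
          (add_le_add (measure_union_le _ _) le_rfl))
    _ ≤ ENNReal.ofReal δ + ENNReal.ofReal δ + ENNReal.ofReal δ := by
        rw [(rep S).2.measure_preimage hm.nullMeasurableSet,
          (rep S₀).2.measure_preimage hm.nullMeasurableSet]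
        gcongr
    _ = ENNReal.ofReal (3 * δ) := by
        rw [← ENNReal.ofReal_add hδ.le hδ.le, ← ENNReal.ofReal_add (by positivity) hδ.le]
        congr 1
        ring
    _ ≤ ε := hδε

/-- Slice over the first coordinate. Almost every slice has finite measure and converges by the
one-dimensional case, and twice the slice measure of `C` dominates. -/
theorem tendsto_volume_symmDiff_prodMap (T : Transformation) (S₀ : M) {C : Set (ℝ × ℝ)}
    (hC : MeasurableSet C) (hC' : (volume.prod volume) C ≠ ⊤) :
    Filter.Tendsto (fun S : M => (volume.prod volume)
      ((prodMap T (rep S) ⁻¹' C) ∆ (prodMap T (rep S₀) ⁻¹' C))) (nhds S₀) (nhds 0) := by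
  have hpm : ∀ S : Transformation, MeasurableSet (prodMap T S ⁻¹' C) := fun S =>
    (measurePreserving_prodMap T S).measurable hC
  have hsl : ∀ x, MeasurableSet (Prod.mk (T.1 x) ⁻¹' C) := fun x => measurable_prodMk_left hC
  have hslice : ∀ S : M, (volume.prod volume)
      ((prodMap T (rep S) ⁻¹' C) ∆ (prodMap T (rep S₀) ⁻¹' C)) =
      ∫⁻ x, volume (((rep S).1 ⁻¹' (Prod.mk (T.1 x) ⁻¹' C)) ∆
        ((rep S₀).1 ⁻¹' (Prod.mk (T.1 x) ⁻¹' C))) := fun S =>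
    Measure.prod_apply ((hpm _).symmDiff (hpm _))
  have hb : Measurable fun x => 2 * volume (Prod.mk x ⁻¹' C) :=
    (measurable_measure_prodMk_left hC).const_mul 2
  simp only [hslice]
  have key := tendsto_lintegral_filter_of_dominated_convergence (μ := (volume : Measure ℝ))
    (l := nhds S₀) (F := fun S x => volume (((rep S).1 ⁻¹' (Prod.mk (T.1 x) ⁻¹' C)) ∆
        ((rep S₀).1 ⁻¹' (Prod.mk (T.1 x) ⁻¹' C)))) (f := fun _ => 0)
    (fun x => 2 * volume (Prod.mk (T.1 x) ⁻¹' C)) ?_ ?_ ?_ ?_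
  · simpa using key
  · exact Filter.Eventually.of_forall fun S =>
      measurable_measure_prodMk_left ((hpm (rep S)).symmDiff (hpm (rep S₀)))
  · refine Filter.Eventually.of_forall fun S => Filter.Eventually.of_forall fun x => ?_
    refine (measure_mono symmDiff_subset_union).trans ((measure_union_le _ _).trans ?_)
    rw [(rep S).2.measure_preimage (hsl x).nullMeasurableSet,
      (rep S₀).2.measure_preimage (hsl x).nullMeasurableSet, two_mul]
  · rw [T.2.lintegral_comp hb, lintegral_const_mul _ (measurable_measure_prodMk_left hC),
      ← Measure.prod_apply hC]
    exact ENNReal.mul_ne_top ENNReal.ofNat_ne_top hC'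
  · filter_upwards [T.2.quasiMeasurePreserving.ae (Measure.ae_measure_lt_top hC hC')] with x hx
    exact tendsto_volume_symmDiff S₀ (hsl x) hx.ne

theorem tendsto_lintegral_comp_prodMap_sub (T : Transformation) (S₀ : M) {g : ℝ × ℝ → ℝ}
    (hg : g ∈ indicatorGroup (volume.prod volume)) :
    Filter.Tendsto (fun S : M => ∫⁻ z, ‖g (prodMap T (rep S) z) - g (prodMap T (rep S₀) z)‖ₑ
      ∂(volume.prod volume)) (nhds S₀) (nhds 0) := by
  have hmeas : ∀ S : M, Measurable (prodMap T (rep S)) := fun S =>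
    (measurePreserving_prodMap T (rep S)).measurable
  induction hg using AddSubgroup.closure_induction with
  | mem f hf =>
    obtain ⟨C, hC, hC', rfl⟩ := hf
    refine tendsto_of_tendsto_of_tendsto_of_le_of_le tendsto_const_nhds
      (tendsto_volume_symmDiff_prodMap T S₀ hC hC') (fun _ => zero_le) fun S => ?_
    rw [← lintegral_indicator_one ((hmeas S hC).symmDiff (hmeas S₀ hC))]
    refine lintegral_mono fun z => ?_
    by_cases h1 : prodMap T (rep S) z ∈ C <;> by_cases h2 : prodMap T (rep S₀) z ∈ C <;>
      simp [h1, h2, indicator, mem_symmDiff]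
  | zero => simp
  | add f h hf' hh' hf hh =>
    have hs := hf.add hh
    rw [add_zero] at hs
    refine tendsto_of_tendsto_of_tendsto_of_le_of_le tendsto_const_nhds hs (fun _ => zero_le)
      fun S => ?_
    have hfm := measurable_of_mem_indicatorGroup hf'
    have hm : Measurable fun z => f (prodMap T (rep S) z) - f (prodMap T (rep S₀) z) :=
      (hfm.comp (hmeas S)).sub (hfm.comp (hmeas S₀))
    dsimp only
    rw [← lintegral_add_left hm.enorm]
    refine lintegral_mono fun z => ?_
    simp only [Pi.add_apply, add_sub_add_comm]
    exact enorm_add_le _ _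
  | neg f _ hf =>
    refine hf.congr fun S => lintegral_congr fun z => ?_
    rw [Pi.neg_apply, Pi.neg_apply, ← enorm_neg]
    congr 1
    ring

/-- The function `g` that works for `S₀` works for all nearby `S`: the strict inequality leaves room
for the `L¹` change of `g ∘ (T × S)`. -/
theorem isOpen_nearCoboundary (T : Transformation) {A B : Set (ℝ × ℝ)} (hA : MeasurableSet A)
    (hB : MeasurableSet B) (ε : ℝ) :
    IsOpen {S : M | NearCoboundary (volume.prod volume) (prodMap T (rep S)) A B ε} := by
  rw [isOpen_iff_mem_nhds]
  rintro S₀ ⟨g, hg, hlt⟩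
  have hgm := measurable_of_mem_indicatorGroup hg
  have hmeas : ∀ S : M, Measurable (prodMap T (rep S)) := fun S =>
    (measurePreserving_prodMap T (rep S)).measurable
  have ht := tendsto_lintegral_comp_prodMap_sub T S₀ hg
  have hev := ht.eventually (gt_mem_nhds (tsub_pos_of_lt hlt))
  filter_upwards [hev] with S hS
  refine ⟨g, hg, ?_⟩
  rw [lt_tsub_iff_left] at hS
  refine lt_of_le_of_lt ?_ hS
  have hm : Measurable fun z => A.indicator (1 : ℝ × ℝ → ℝ) z - B.indicator (1 : ℝ × ℝ → ℝ) z -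
      (g z - g (prodMap T (rep S₀) z)) :=
    ((measurable_one.indicator hA).sub (measurable_one.indicator hB)).sub
      (hgm.sub (hgm.comp (hmeas S₀)))
  rw [← lintegral_add_left hm.enorm]
  refine lintegral_mono fun z => ?_
  refine le_trans (le_of_eq ?_) (enorm_add_le _ _)
  congr 1
  ring

/-! ### Products and conjugacy -/

/-- The product of two transformations as an equivalence. -/
def prodEquiv (T S : Transformation) : ℝ × ℝ ≃ᵐ ℝ × ℝ := MeasurableEquiv.prodCongr T.1 S.1

theorem prodErgodic_toM (T S : Transformation) :
    ProdErgodic (toM T) (toM S) ↔ Ergodic (prodMap T S) (volume.prod volume) := Iff.rfl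

theorem prodConservative_toM (T S : Transformation) :
    ProdConservative (toM T) (toM S) ↔ Conservative (prodMap T S) (volume.prod volume) := Iff.rfl

theorem isErgodic_toM (S : Transformation) : IsErgodic (toM S) ↔ Ergodic S.1 volume := Iff.rfl

/-- An invariant set `s` gives the invariant strip `ℝ × s`, and a strip is null only if its base is.
-/
theorem ergodic_of_ergodic_prodMap {T S : Transformation}
    (h : Ergodic (prodMap T S) (volume.prod volume)) : Ergodic S.1 volume := by
  refine ⟨S.2, ⟨fun s hs hSs => ?_⟩⟩
  have h1 := h.aeconst_set (s := Prod.snd ⁻¹' s) (measurable_snd hs) (by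
    ext z
    change S.1 z.2 ∈ s ↔ z.2 ∈ s
    rw [← mem_preimage, hSs])
  rw [Filter.eventuallyConst_set'] at h1 ⊢
  have key : ∀ t : Set ℝ, (volume.prod volume) (Prod.snd ⁻¹' t : Set (ℝ × ℝ)) = 0 →
      volume t = 0 := by
    intro t ht
    have : (Prod.snd ⁻¹' t : Set (ℝ × ℝ)) = univ ×ˢ t := by
      ext z
      simp
    rw [this, Measure.prod_prod, Real.volume_univ, ENNReal.top_mul'] at ht
    by_contra hne
    simp [hne] at ht
  refine h1.imp (fun h2 => ?_) fun h2 => ?_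
  · exact ae_eq_empty.2 (key s (ae_eq_empty.1 h2))
  · exact ae_eq_univ.2 (key sᶜ (ae_eq_univ.1 h2))

theorem E_eq_setOf_prodErgodic (T : M) : E T = {S | ProdErgodic T S} := by
  ext S
  obtain ⟨T, rfl⟩ := exists_toM T
  obtain ⟨S, rfl⟩ := exists_toM S
  exact ⟨fun h => h.2, fun h => ⟨ergodic_of_ergodic_prodMap h, h⟩⟩

/-- Ergodicity of the product is a countable intersection of the open near-coboundary conditions,
over a countable dense family of sets in the plane. -/
theorem isGδ_E (T : M) : IsGδ (E T) := by
  obtain ⟨T, rfl⟩ := exists_toM T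
  obtain ⟨𝒜, hc, h𝒜⟩ :=
    exists_countable_measureDense ((volume : Measure ℝ).prod (volume : Measure ℝ))
  have : E (toM T) = ⋂ A ∈ {A ∈ 𝒜 | (volume.prod volume) A ≠ ⊤},
      ⋂ B ∈ {B ∈ 𝒜 | (volume.prod volume) B ≠ ⊤}, ⋂ n : ℕ,
        {S : M | NearCoboundary (volume.prod volume) (prodMap T (rep S)) A B (1 / (n + 1))} := by
    rw [E_eq_setOf_prodErgodic]
    ext S
    simp only [mem_iInter, mem_ofPred_eq]
    have hS : ProdErgodic (toM T) S ↔ Ergodic (prodEquiv T (rep S)) (volume.prod volume) := by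
      conv_lhs => rw [← toM_rep S]
      exact Iff.rfl
    rw [hS]
    constructor
    · intro h A hA B hB n
      exact nearCoboundary_of_ergodic h (h𝒜.measurable A hA.1) (h𝒜.measurable B hB.1) hA.2 hB.2
        (by positivity)
    · intro h
      exact ergodic_of_nearCoboundary (measurePreserving_prodMap T (rep S)) h𝒜
        fun A hA B hB hA' hB' n => h A ⟨hA, hA'⟩ B ⟨hB, hB'⟩ n
  rw [this]
  refine IsGδ.biInter (hc.mono fun A hA => hA.1) fun A hA => ?_
  refine IsGδ.biInter (hc.mono fun B hB => hB.1) fun B hB => ?_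
  exact IsGδ.iInter fun n =>
    (isOpen_nearCoboundary T (h𝒜.measurable A hA.1) (h𝒜.measurable B hB.1) _).isGδ

theorem isErgodic_conjugate (R S : Transformation) :
    IsErgodic (toM (conjugate R S)) ↔ IsErgodic (toM S) := by
  rw [isErgodic_toM, isErgodic_toM]
  exact R.2.ergodic_conjugate_iff (f := S.1)

/-- The transformation of the plane that applies `R` to the second coordinate. -/
def secondEquiv (R : Transformation) : ℝ × ℝ ≃ᵐ ℝ × ℝ :=
  MeasurableEquiv.prodCongr (MeasurableEquiv.refl ℝ) R.1

theorem measurePreserving_secondEquiv (R : Transformation) :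
    MeasurePreserving (secondEquiv R) (volume.prod volume) (volume.prod volume) :=
  (MeasurePreserving.id volume).prod R.2

theorem prodMap_conjugate (T R S : Transformation) : prodMap T (conjugate R S) =
    secondEquiv R ∘ prodMap T S ∘ (secondEquiv R).symm := rfl

theorem prodErgodic_conjugate (T : M) (R S : Transformation) :
    ProdErgodic T (toM (conjugate R S)) ↔ ProdErgodic T (toM S) := by
  obtain ⟨T, rfl⟩ := exists_toM T
  rw [prodErgodic_toM, prodErgodic_toM, prodMap_conjugate]
  exact (measurePreserving_secondEquiv R).ergodic_conjugate_iff

/-- A point of `e ⁻¹' s` that returns there under `f` is carried by `e` to a point of `s` that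
returns under the conjugate. -/
theorem conservative_conjugate {X : Type*} [MeasurableSpace X] {μ : Measure X} {e : X ≃ᵐ X}
    (he : MeasurePreserving e μ μ) {f : X → X} (hf : Conservative f μ) :
    Conservative (e ∘ f ∘ e.symm) μ := by
  refine ⟨he.quasiMeasurePreserving.comp
    (hf.toQuasiMeasurePreserving.comp (he.symm e).quasiMeasurePreserving), fun s hs hs0 => ?_⟩
  obtain ⟨x, hx, m, hm, hxm⟩ := hf.exists_mem_iterate_mem' (e.measurable hs)
    (by rwa [he.measure_preimage hs.nullMeasurableSet])
  have hsemi : Function.Semiconj e f (e ∘ f ∘ e.symm) := fun y => by simp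
  refine ⟨e x, hx, m, hm, ?_⟩
  rw [← (hsemi.iterate_right m).eq]
  exact hxm

theorem conservative_conjugate_iff {X : Type*} [MeasurableSpace X] {μ : Measure X} {e : X ≃ᵐ X}
    (he : MeasurePreserving e μ μ) {f : X → X} :
    Conservative (e ∘ f ∘ e.symm) μ ↔ Conservative f μ := by
  refine ⟨fun h => ?_, conservative_conjugate he⟩
  have := conservative_conjugate (he.symm e) h
  convert this using 1
  funext x
  simp

theorem prodConservative_conjugate (T : M) (R S : Transformation) :
    ProdConservative T (toM (conjugate R S)) ↔ ProdConservative T (toM S) := by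
  obtain ⟨T, rfl⟩ := exists_toM T
  rw [prodConservative_toM, prodConservative_toM, prodMap_conjugate]
  exact conservative_conjugate_iff (measurePreserving_secondEquiv R)

/-- A conjugation invariant set that contains an anti-periodic transformation is dense. -/
theorem dense_of_conjugate_mem {S : Transformation} (hS : AntiPeriodic S) {𝒮 : Set M}
    (h : ∀ R, toM (conjugate R S) ∈ 𝒮) : Dense 𝒮 :=
  hS.dense_conjugates.mono (by
    rintro _ ⟨R, rfl⟩
    exact h R)

end ErgodicCategory

end

/-! ### The category theorem. -/

theorem mainTheorem8 (T S : ErgodicCategory.M) (hS : ErgodicCategory.IsAntiPeriodic S) :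
    (S ∈ ErgodicCategory.E T →
      Dense (ErgodicCategory.E T) ∧ IsGδ (ErgodicCategory.E T)) ∧
    (S ∈ ErgodicCategory.EbarC T → Dense (ErgodicCategory.EbarC T)) ∧
    (S ∈ ErgodicCategory.Cbar T → Dense (ErgodicCategory.Cbar T)) := by
  obtain ⟨S, rfl⟩ := ErgodicCategory.exists_toM S
  replace hS : ErgodicCategory.AntiPeriodic S := hS
  refine ⟨fun h => ⟨ErgodicCategory.dense_of_conjugate_mem hS fun R => ?_,
    ErgodicCategory.isGδ_E T⟩, fun h => ErgodicCategory.dense_of_conjugate_mem hS fun R => ?_,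
    fun h => ErgodicCategory.dense_of_conjugate_mem hS fun R => ?_⟩
  · exact ⟨(ErgodicCategory.isErgodic_conjugate R S).2 h.1,
      (ErgodicCategory.prodErgodic_conjugate T R S).2 h.2⟩
  · exact ⟨(ErgodicCategory.isErgodic_conjugate R S).2 h.1,
      (ErgodicCategory.prodConservative_conjugate T R S).2 h.2.1,
      fun h' => h.2.2 ((ErgodicCategory.prodErgodic_conjugate T R S).1 h')⟩
  · exact ⟨(ErgodicCategory.isErgodic_conjugate R S).2 h.1,
      fun h' => h.2 ((ErgodicCategory.prodConservative_conjugate T R S).1 h')⟩
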